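/- Let $\mathrm{Ai}$ be the Airy function and $0>\mathrm a_1>\mathrm a_2>\cdots$ its negative zeros. For $z>1$ define $\zeta=\zeta(z)<0$ and $\sigma=\sigma(z)>0$ by $$\tfrac23(-\zeta)^{3/2}=\int_1^z\frac{(t^2-1)^{1/2}}{t}\,dt=(z^2-1)^{1/2}-\operatorname{arcsec}z,\qquad \sigma=\Bigl(\frac{\zeta}{1-z^2}\Bigr)^{1/2},$$ and put $$\hat z_1(z)=\frac{z\sigma}{48\zeta^2}\{10\sigma^3-6\sigma\zeta-5\},$$ $$\begin{aligned}\hat z_2(z)=\frac{z\sigma}{46080\,\zeta^5}\{&200\sigma^9(35z^2+221)-80\sigma^7\zeta(75z^2+982)-4000\sigma^6z^2+24\sigma^5\zeta^2(45z^2+1543)\\&+200\sigma^4\zeta(6z^2-5)+600\sigma^2\zeta^2+10\sigma^3(25z^2-264\zeta^3)+250\sigma\zeta-5525\},\end{aligned}$$ $$\begin{aligned}\hat z_3(z)=\frac{z\sigma}{92897280\,\zeta^8}\{&28000\sigma^{15}(650z^4+8619z^2+89451)-5600\sigma^{13}\zeta(3960z^4+86491z^2+1338450)\\&-420000z^2\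sigma^{12}(35z^2+221)+1120\sigma^{11}\zeta^2(7290z^4+282717z^2+7233983)\\&+8400\sigma^{10}\zeta(1200z^4+15187z^2-1105)\\&-672\sigma^9(1260z^4\zeta^3+107859z^2\zeta^3-4375z^4+5551275\zeta^3)\\&-3360\sigma^8\zeta^2(405z^4+12762z^2-4910)\\&+24\sigma^7\zeta(136080z^2\zeta^3-26250z^4+26578824\zeta^3+74375z^2)\\&+560\sigma^6(2745z^2\zeta^3-125z^4-13887\zeta^3-16575z^2)\\&-168\sigma^5\zeta^2(111564\zeta^3+3375z^2-625)+700\sigma^4\zeta(792\zeta^3+3853z^2-3315)\\&-5250\sigma^3(12\zeta^3-221z^2)+1374800\sigma^2\zeta^2+1160250\sigma\zeta-78269625\},\end{aligned}$$ $$\Upsilon_1(z)=\frac1{48\zeta^2}\{10\sigma^3-6\sigma\zeta-5\},$$ $$\begin{aligned}\Upsilon_2(z)=\frac1{11520\,\zeta^5}\{&11050\sigma^9-19890\sigma^7\zeta+9558\sigma^5\zeta^2-125\sigma^6+150\sigma^4\zeta-45\sigma^2\zeta^2\\&-250(3\zeta^3-2)\sigma^3-300\sigma\zeta-1600\},\end{aligned}$$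 $$\begin{aligned}\Upsilon_3(z)=\frac1{5806080\,\zeta^8}\{&156539250\sigma^{15}-469617750\sigma^{13}\zeta+509154660\sigma^{11}\zeta^2-580125\sigma^{12}\\&+1392300\sigma^{10}\zeta-1128330\sigma^8\zeta^2-140(1681389\zeta^3-8350)\sigma^9\\&+90(450441\zeta^3-23380)\sigma^7\zeta-378(3219\zeta^3-2680)\sigma^5\zeta^2+147(2316\zeta^3-625)\sigma^6\\&-7875(3\zeta^3-14)\sigma^4\zeta-33075\sigma^2\zeta^2-6720(12\zeta^3-125)\sigma^3-504000\sigma\zeta-5398750\},\end{aligned}$$ $$\mathcal Z_3(\nu,z)=\zeta(z)+\frac{\Upsilon_1(z)}{\nu^2}+\frac{\Upsilon_2(z)}{\nu^4}+\frac{\Upsilon_3(z)}{\nu^6}.$$ Then for every integer $m\ge1$ and every real $\nu\ge1$ the following hold. There is a unique $z_{m,0}\in(1,\infty)$ with $\zeta(z_{m,0})=\nu^{-2/3}\mathrm a_m$, and the function $z\mapsto\mathcal Z_3(\nu,z)-\mathrm a_m\nu^{-2/3}$ has a unique zero $\hat z_{\nu,m}$ in $(1,\infty)$. With $z_{m,j}=\hat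 z_j(z_{m,0})$ for $j=1,2,3$ and $$\mathbf z_{\nu,m}=z_{m,0}+\frac{z_{m,1}}{\nu^2}+\frac{z_{m,2}}{\nu^4},$$ one has $\hat z_{\nu,m}=\mathbf z_{\nu,m}+\mathbf e_{\nu,m}$, where $$\frac{0.969746\,z_{m,3}}{\nu^6}<\mathbf e_{\nu,m}<\frac{1.013023\,z_{m,3}}{\nu^6}.$$ -/

import Mathlib

noncomputable section

namespace BesselZeros

/-- The Airy function `Ai` on the real line, by its everywhere convergent Maclaurin series
`Ai x = Ai(0) (1 + x³/3! + 1·4 x⁶/6! + 1·4·7 x⁹/9! + ⋯) + Ai'(0) (x + 2 x⁴/4! + 2·5 x⁷/7! + ⋯)`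
with `Ai(0) = 3^(-2/3) / Γ(2/3)` and `Ai'(0) = -3^(-1/3) / Γ(1/3)`. -/
def airyAi (x : ℝ) : ℝ :=
  1 / ((3 : ℝ) ^ (2 / 3 : ℝ) * Real.Gamma (2 / 3)) *
      ∑' k : ℕ, (∏ i ∈ Finset.range k, (3 * (i : ℝ) + 1)) / ((3 * k).factorial : ℝ) * x ^ (3 * k)
    - 1 / ((3 : ℝ) ^ (1 / 3 : ℝ) * Real.Gamma (1 / 3)) *
      ∑' k : ℕ, (∏ i ∈ Finset.range k, (3 * (i : ℝ) + 2)) / ((3 * k + 1).factorial : ℝ) *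
        x ^ (3 * k + 1)

/-- The negative zeros `0 > a₁ > a₂ > ⋯` of `Ai`: `a₁` is the largest negative zero and `aₘ₊₁` the
largest zero below `aₘ`. The value `0` at index `0` only starts the recursion. -/
def airyZero : ℕ → ℝ
  | 0 => 0
  | m + 1 => sSup {x : ℝ | x < airyZero m ∧ airyAi x = 0}

/-- The Liouville variable for `z ≥ 1`: `(2/3) (-ζ)^(3/2) = √(z² - 1) - arcsec z`, `ζ ≤ 0`. -/
def zeta (z : ℝ) : ℝ :=
  -(3 / 2 * (Real.sqrt (z ^ 2 - 1) - Real.arccos (1 / z))) ^ (2 / 3 : ℝ)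

/-- `σ = (ζ / (1 - z²))^(1/2)`, used for `z > 1`. -/
def sigma (z : ℝ) : ℝ := Real.sqrt (zeta z / (1 - z ^ 2))

/-- The coefficient function `ẑ₁`. -/
def zHat1 (z : ℝ) : ℝ :=
  let ζ := zeta z
  let σ := sigma z
  z * σ / (48 * ζ ^ 2) * (10 * σ ^ 3 - 6 * σ * ζ - 5)

/-- The coefficient function `ẑ₂`. -/
def zHat2 (z : ℝ) : ℝ :=
  let ζ := zeta z
  let σ := sigma z
  z * σ / (46080 * ζ ^ 5) *
    (200 * σ ^ 9 * (35 * z ^ 2 + 221)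
      - 80 * σ ^ 7 * ζ * (75 * z ^ 2 + 982)
      - 4000 * σ ^ 6 * z ^ 2
      + 24 * σ ^ 5 * ζ ^ 2 * (45 * z ^ 2 + 1543)
      + 200 * σ ^ 4 * ζ * (6 * z ^ 2 - 5)
      + 600 * σ ^ 2 * ζ ^ 2
      + 10 * σ ^ 3 * (25 * z ^ 2 - 264 * ζ ^ 3)
      + 250 * σ * ζ - 5525)

/-- The coefficient function `ẑ₃`. -/
def zHat3 (z : ℝ) : ℝ :=
  let ζ := zeta z
  let σ := sigma z
  z * σ / (92897280 * ζ ^ 8) *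
    (28000 * σ ^ 15 * (650 * z ^ 4 + 8619 * z ^ 2 + 89451)
      - 5600 * σ ^ 13 * ζ * (3960 * z ^ 4 + 86491 * z ^ 2 + 1338450)
      - 420000 * z ^ 2 * σ ^ 12 * (35 * z ^ 2 + 221)
      + 1120 * σ ^ 11 * ζ ^ 2 * (7290 * z ^ 4 + 282717 * z ^ 2 + 7233983)
      + 8400 * σ ^ 10 * ζ * (1200 * z ^ 4 + 15187 * z ^ 2 - 1105)
      - 672 * σ ^ 9 *
          (1260 * z ^ 4 * ζ ^ 3 + 107859 * z ^ 2 * ζ ^ 3 - 4375 * z ^ 4 + 5551275 * ζ ^ 3)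
      - 3360 * σ ^ 8 * ζ ^ 2 * (405 * z ^ 4 + 12762 * z ^ 2 - 4910)
      + 24 * σ ^ 7 * ζ *
          (136080 * z ^ 2 * ζ ^ 3 - 26250 * z ^ 4 + 26578824 * ζ ^ 3 + 74375 * z ^ 2)
      + 560 * σ ^ 6 * (2745 * z ^ 2 * ζ ^ 3 - 125 * z ^ 4 - 13887 * ζ ^ 3 - 16575 * z ^ 2)
      - 168 * σ ^ 5 * ζ ^ 2 * (111564 * ζ ^ 3 + 3375 * z ^ 2 - 625)
      + 700 * σ ^ 4 * ζ * (792 * ζ ^ 3 + 3853 * z ^ 2 - 3315)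
      - 5250 * σ ^ 3 * (12 * ζ ^ 3 - 221 * z ^ 2)
      + 1374800 * σ ^ 2 * ζ ^ 2 + 1160250 * σ * ζ - 78269625)

/-- The coefficient function `Υ₁`. -/
def upsilon1 (z : ℝ) : ℝ :=
  let ζ := zeta z
  let σ := sigma z
  1 / (48 * ζ ^ 2) * (10 * σ ^ 3 - 6 * σ * ζ - 5)

/-- The coefficient function `Υ₂`. -/
def upsilon2 (z : ℝ) : ℝ :=
  let ζ := zeta z
  let σ := sigma z
  1 / (11520 * ζ ^ 5) *
    (11050 * σ ^ 9 - 19890 * σ ^ 7 * ζ + 9558 * σ ^ 5 * ζ ^ 2 - 125 * σ ^ 6 + 150 * σ ^ 4 * ζ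
      - 45 * σ ^ 2 * ζ ^ 2 - 250 * (3 * ζ ^ 3 - 2) * σ ^ 3 - 300 * σ * ζ - 1600)

/-- The coefficient function `Υ₃`. -/
def upsilon3 (z : ℝ) : ℝ :=
  let ζ := zeta z
  let σ := sigma z
  1 / (5806080 * ζ ^ 8) *
    (156539250 * σ ^ 15 - 469617750 * σ ^ 13 * ζ + 509154660 * σ ^ 11 * ζ ^ 2
      - 580125 * σ ^ 12 + 1392300 * σ ^ 10 * ζ - 1128330 * σ ^ 8 * ζ ^ 2
      - 140 * (1681389 * ζ ^ 3 - 8350) * σ ^ 9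
      + 90 * (450441 * ζ ^ 3 - 23380) * σ ^ 7 * ζ
      - 378 * (3219 * ζ ^ 3 - 2680) * σ ^ 5 * ζ ^ 2
      + 147 * (2316 * ζ ^ 3 - 625) * σ ^ 6
      - 7875 * (3 * ζ ^ 3 - 14) * σ ^ 4 * ζ
      - 33075 * σ ^ 2 * ζ ^ 2
      - 6720 * (12 * ζ ^ 3 - 125) * σ ^ 3
      - 504000 * σ * ζ - 5398750)

/-- `𝒵₃(ν, z) = ζ + Υ₁/ν² + Υ₂/ν⁴ + Υ₃/ν⁶`. -/
def scriptZ3 (ν z : ℝ) : ℝ :=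
  zeta z + upsilon1 z / ν ^ 2 + upsilon2 z / ν ^ 4 + upsilon3 z / ν ^ 6

/-- The solutions `z` in `(1, ∞)` of `ζ(z) = ν^(-2/3) aₘ`. -/
def zLeadSet (ν : ℝ) (m : ℕ) : Set ℝ :=
  {z | 1 < z ∧ zeta z = ν ^ (-(2 / 3) : ℝ) * airyZero m}

/-- The leading coefficient `z_{m,0}`: the element of `zLeadSet ν m`. -/
def zLead (ν : ℝ) (m : ℕ) : ℝ := sInf (zLeadSet ν m)

/-- The zeros `z` in `(1, ∞)` of `𝒵₃(ν, z) - aₘ ν^(-2/3)`. -/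
def zImplicitSet (ν : ℝ) (m : ℕ) : Set ℝ :=
  {z | 1 < z ∧ scriptZ3 ν z - airyZero m * ν ^ (-(2 / 3) : ℝ) = 0}

/-- `ẑ_{ν,m}`: the element of `zImplicitSet ν m`. -/
def zImplicit (ν : ℝ) (m : ℕ) : ℝ := sInf (zImplicitSet ν m)

/-- The truncated approximation `𝐳_{ν,m} = z_{m,0} + z_{m,1}/ν² + z_{m,2}/ν⁴`,
where `z_{m,j} = ẑⱼ(z_{m,0})`. -/
def zBold (ν : ℝ) (m : ℕ) : ℝ :=
  zLead ν m + zHat1 (zLead ν m) / ν ^ 2 + zHat2 (zLead ν m) / ν ^ 4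

end BesselZeros

end

namespace BesselZeros

/-! Put `w = -ζ`, `e = 1/ν²` and `K(e, z) = w - e Υ₁ - e² Υ₂ - e³ Υ₃ = -𝒵₃(ν, z)`. The leading point
`z` satisfies `w(z) = c` and the implicit zero `x` satisfies `K(e, x) = c`, with the same `c =
-ν^(-2/3) aₘ`. The only fact about Airy zeros that is needed is `aₘ < 0`, so that `c > 0`. As `w`
and `K(e, ·)` are strictly increasing on `(1, ∞)`, everything reduces to bracketing: for `l =
0.969746` the value of `K` at `z + e ẑ₁ + e² ẑ₂ + l e³ ẑ₃` is below `c`, and for `l = 1.013023` it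
is above (`kFun_lower_lt`, `lt_kFun_upper`).

The `ẑⱼ` are the formal reversion coefficients, so in the expansion of `K - c` in powers of `e` the
orders 1 and 2 cancel and order 3 leaves `(l - 1) ẑ₃ w'`. One-sided Taylor bounds, with the first
omitted derivative of known sign, reduce the rest to terms of order `e⁴`; since `e ≤ 1`, these are
beaten by order 3 as soon as one inequality in `z` alone holds (`reversion_lower`,
`reversion_upper`).

All such conditions on `z` are decided by computation. With `q = 3 (1 - arcsec z / √(z² - 1))`, `U =
z²/(z² - 1)` and `V = 1/q`, the functions `w`, `Υⱼ` and their derivatives have the form `w z⁻ⁿ B(U,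
V)` with `B` a polynomial with integer coefficients up to a constant factor, and the `ẑⱼ` the same
form without `w`. Differentiation acts on `B` by an explicit rule (`bStep`). Positivity of `B(U, V)`
for all `z > 1` follows by replacing `q` with a rational function of `z - 1`, paying for the error
with a Lipschitz bound, and seeing only non-negative coefficients (`bEval_pos_of_posCheck`). -/

/-! ### Polynomials with integer coefficients as lists -/

/-- The value at `x` of the polynomial with coefficient list `l`, constant term first. -/
noncomputable def lEval : List ℤ → ℝ → ℝ
  | [], _ => 0
  | a :: l, x => a + x * lEval l x

/-- The derivative of `lEval l`. -/
noncomputable def lEvalD : List ℤ → ℝ → ℝ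
  | [], _ => 0
  | _ :: l, x => lEval l x + x * lEvalD l x

def lAdd : List ℤ → List ℤ → List ℤ
  | [], m => m
  | a :: l, [] => a :: l
  | a :: l, b :: m => (a + b) :: lAdd l m

def lSmul (c : ℤ) : List ℤ → List ℤ
  | [] => []
  | a :: l => c * a :: lSmul c l

def lMul : List ℤ → List ℤ → List ℤ
  | [], _ => []
  | a :: l, m => lAdd (lSmul a m) (0 :: lMul l m)

def lPow (l : List ℤ) : ℕ → List ℤ
  | 0 => [1]
  | n + 1 => lMul l (lPow l n)

/-- The coefficient list of the derivative of `x ^ i * l`, divided by `x ^ (i - 1)`. -/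
def lDerivAux : ℤ → List ℤ → List ℤ
  | _, [] => []
  | i, a :: l => i * a :: lDerivAux (i + 1) l

def lDeriv : List ℤ → List ℤ
  | [] => []
  | _ :: l => lDerivAux 1 l

@[simp] lemma lEval_nil (x : ℝ) : lEval [] x = 0 := rfl

@[simp] lemma lEval_cons (a : ℤ) (l : List ℤ) (x : ℝ) : lEval (a :: l) x = a + x * lEval l x := rfl

@[simp] lemma lEval_lAdd (l m : List ℤ) (x : ℝ) : lEval (lAdd l m) x = lEval l x + lEval m x := by
  induction l generalizing m with
  | nil => simp [lAdd]
  | cons a l ih =>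
    cases m with
    | nil => simp [lAdd]
    | cons b m => simp only [lAdd, lEval_cons, ih]; push_cast; ring

@[simp] lemma lEval_lSmul (c : ℤ) (l : List ℤ) (x : ℝ) : lEval (lSmul c l) x = c * lEval l x := by
  induction l with
  | nil => simp [lSmul]
  | cons a l ih => simp only [lSmul, lEval_cons, ih]; push_cast; ring

@[simp] lemma lEval_lMul (l m : List ℤ) (x : ℝ) : lEval (lMul l m) x = lEval l x * lEval m x := by
  induction l with
  | nil => simp [lMul]
  | cons a l ih => simp only [lMul, lEval_cons, lEval_lAdd, lEval_lSmul, ih]; push_cast; ring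

@[simp] lemma lEval_lPow (l : List ℤ) (n : ℕ) (x : ℝ) : lEval (lPow l n) x = lEval l x ^ n := by
  induction n with
  | zero => simp [lPow]
  | succ n ih => simp only [lPow, lEval_lMul, ih]; ring

lemma lEval_lDerivAux (i : ℤ) (l : List ℤ) (x : ℝ) :
    lEval (lDerivAux i l) x = i * lEval l x + x * lEvalD l x := by
  induction l generalizing i with
  | nil => simp [lDerivAux, lEvalD]
  | cons a l ih => simp only [lDerivAux, lEval_cons, ih, lEvalD]; push_cast; ring

lemma lEval_lDeriv (l : List ℤ) (x : ℝ) : lEval (lDeriv l) x = lEvalD l x := by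
  cases l with
  | nil => rfl
  | cons a l => simp [lDeriv, lEval_lDerivAux, lEvalD]

lemma hasDerivAt_lEval (l : List ℤ) (x : ℝ) : HasDerivAt (lEval l) (lEvalD l x) x := by
  induction l with
  | nil => exact hasDerivAt_const x 0
  | cons a l ih =>
    have := ((hasDerivAt_id x).mul ih).const_add (a : ℝ)
    exact this.congr_deriv (by simp [lEvalD])

def lNonneg (l : List ℤ) : Bool := l.all fun a => decide (0 ≤ a)

def lPosCheck (l : List ℤ) : Bool := lNonneg l && l.any fun a => decide (0 < a)

lemma lEval_nonneg {l : List ℤ} (h : lNonneg l = true) {x : ℝ} (hx : 0 ≤ x) : 0 ≤ lEval l x := by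
  induction l with
  | nil => simp
  | cons a l ih =>
    simp only [lNonneg, List.all_cons, Bool.and_eq_true, decide_eq_true_eq] at h
    have h1 : (0 : ℝ) ≤ a := by exact_mod_cast h.1
    have h2 := ih h.2
    rw [lEval_cons]; positivity

lemma lEval_pos {l : List ℤ} (h : lPosCheck l = true) {x : ℝ} (hx : 0 < x) : 0 < lEval l x := by
  induction l with
  | nil => simp [lPosCheck] at h
  | cons a l ih =>
    simp only [lPosCheck, lNonneg, List.all_cons, List.any_cons, Bool.and_eq_true, Bool.or_eq_true,
      decide_eq_true_eq] at h
    have h1 : (0 : ℝ) ≤ a := by exact_mod_cast h.1.1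
    have h2 : 0 ≤ lEval l x := lEval_nonneg h.1.2 hx.le
    rw [lEval_cons]
    rcases h.2 with h3 | h3
    · have h3 : (0 : ℝ) < a := by exact_mod_cast h3
      positivity
    · have := ih (by simp [lPosCheck, lNonneg, h3, h.1.2])
      positivity

lemma lEval_append_singleton (l : List ℤ) (a : ℤ) (x : ℝ) :
    lEval (l ++ [a]) x = lEval l x + a * x ^ l.length := by
  induction l with
  | nil => simp
  | cons b l ih => simp only [List.cons_append, lEval_cons, ih, List.length_cons]; ring

/-- The extra factor `x` on the left avoids the exponent `l.length - 1`, which would be truncated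
for the empty list. The same device recurs in `bEval_bPadRev`, `lEval_lHom` and `lEval_bHom`. -/
lemma lEval_reverse (l : List ℤ) {x : ℝ} (hx : x ≠ 0) :
    lEval l.reverse x * x = x ^ l.length * lEval l x⁻¹ := by
  induction l with
  | nil => simp
  | cons a l ih =>
    rw [List.reverse_cons, lEval_append_singleton, add_mul, ih, List.length_reverse, lEval_cons,
      List.length_cons]
    field_simp
    ring

lemma lEval_append_replicate (l : List ℤ) (n : ℕ) (x : ℝ) :
    lEval (l ++ List.replicate n 0) x = lEval l x := by
  induction l with
  | nil =>
    induction n with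
    | zero => simp
    | succ n ih => simp only [List.nil_append, List.replicate_succ, lEval_cons] at ih ⊢; simp [ih]
  | cons a l ih => simp [ih]

/-! ### Polynomials in two variables -/

/-- The value at `(x, y)` of `∑ j, B j (x) * y ^ j`. -/
noncomputable def bEval : List (List ℤ) → ℝ → ℝ → ℝ
  | [], _, _ => 0
  | r :: B, x, y => lEval r x + y * bEval B x y

noncomputable def bEvalX : List (List ℤ) → ℝ → ℝ → ℝ
  | [], _, _ => 0
  | r :: B, x, y => lEvalD r x + y * bEvalX B x y

noncomputable def bEvalY : List (List ℤ) → ℝ → ℝ → ℝ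
  | [], _, _ => 0
  | _ :: B, x, y => bEval B x y + y * bEvalY B x y

def bAdd : List (List ℤ) → List (List ℤ) → List (List ℤ)
  | [], C => C
  | r :: B, [] => r :: B
  | r :: B, t :: C => lAdd r t :: bAdd B C

def bRowMul (r : List ℤ) : List (List ℤ) → List (List ℤ)
  | [] => []
  | t :: C => lMul r t :: bRowMul r C

def bMul : List (List ℤ) → List (List ℤ) → List (List ℤ)
  | [], _ => []
  | r :: B, C => bAdd (bRowMul r C) ([] :: bMul B C)

def bSmul (c : ℤ) (B : List (List ℤ)) : List (List ℤ) := bRowMul [c] B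

@[simp] lemma bEval_nil (x y : ℝ) : bEval [] x y = 0 := rfl

@[simp] lemma bEval_cons (r : List ℤ) (B : List (List ℤ)) (x y : ℝ) :
    bEval (r :: B) x y = lEval r x + y * bEval B x y := rfl

@[simp] lemma bEval_bAdd (B C : List (List ℤ)) (x y : ℝ) :
    bEval (bAdd B C) x y = bEval B x y + bEval C x y := by
  induction B generalizing C with
  | nil => simp [bAdd]
  | cons r B ih =>
    cases C with
    | nil => simp [bAdd]
    | cons t C => simp only [bAdd, bEval_cons, ih, lEval_lAdd]; ring

@[simp] lemma bEval_bRowMul (r : List ℤ) (C : List (List ℤ)) (x y : ℝ) :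
    bEval (bRowMul r C) x y = lEval r x * bEval C x y := by
  induction C with
  | nil => simp [bRowMul]
  | cons t C ih => simp only [bRowMul, bEval_cons, ih, lEval_lMul]; ring

@[simp] lemma bEval_bMul (B C : List (List ℤ)) (x y : ℝ) :
    bEval (bMul B C) x y = bEval B x y * bEval C x y := by
  induction B with
  | nil => simp [bMul]
  | cons r B ih => simp only [bMul, bEval_cons, ih, bEval_bAdd, bEval_bRowMul, lEval_nil]; ring

@[simp] lemma bEval_bSmul (c : ℤ) (B : List (List ℤ)) (x y : ℝ) :
    bEval (bSmul c B) x y = c * bEval B x y := by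
  simp [bSmul]

def bZero (B : List (List ℤ)) : Bool := B.all fun r => r.all fun a => decide (a = 0)

lemma lEval_eq_zero {l : List ℤ} (h : (l.all fun a => decide (a = 0)) = true) (x : ℝ) :
    lEval l x = 0 := by
  induction l with
  | nil => rfl
  | cons a l ih =>
    simp only [List.all_cons, Bool.and_eq_true, decide_eq_true_eq] at h
    rw [lEval_cons, ih h.2, h.1]; simp

lemma bEval_eq_zero {B : List (List ℤ)} (h : bZero B = true) (x y : ℝ) : bEval B x y = 0 := by
  induction B with
  | nil => rfl
  | cons r B ih =>
    simp only [bZero, List.all_cons, Bool.and_eq_true] at h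
    rw [bEval_cons, ih h.2, lEval_eq_zero h.1]; simp

lemma hasDerivAt_bEval (B : List (List ℤ)) {f g : ℝ → ℝ} {f' g' t : ℝ} (hf : HasDerivAt f f' t)
    (hg : HasDerivAt g g' t) :
    HasDerivAt (fun t => bEval B (f t) (g t))
      (bEvalX B (f t) (g t) * f' + bEvalY B (f t) (g t) * g') t := by
  induction B with
  | nil => simpa [bEvalX, bEvalY] using hasDerivAt_const t (0 : ℝ)
  | cons r B ih =>
    have h1 : HasDerivAt (fun t => lEval r (f t)) (lEvalD r (f t) * f') t :=
      (hasDerivAt_lEval r (f t)).comp t hf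
    exact (h1.add (hg.mul ih)).congr_deriv (by simp only [bEvalX, bEvalY]; ring)

/-- Remove trailing zeros. -/
def lTrim : List ℤ → List ℤ
  | [] => []
  | a :: l => match lTrim l with
    | [] => if a = 0 then [] else [a]
    | b :: m => a :: b :: m

/-- Only rows are trimmed: the longest row fixes the power of `U` that a certificate has to clear.
-/
def bTrim : List (List ℤ) → List (List ℤ)
  | [] => []
  | r :: B => lTrim r :: bTrim B

@[simp] lemma lEval_lTrim (l : List ℤ) (x : ℝ) : lEval (lTrim l) x = lEval l x := by
  induction l with
  | nil => rfl
  | cons a l ih =>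
    rw [lEval_cons, ← ih, lTrim]
    split
    · next h => split_ifs with ha <;> simp [h, ha]
    · next h => simp [h]

@[simp] lemma bEval_bTrim (B : List (List ℤ)) (x y : ℝ) : bEval (bTrim B) x y = bEval B x y := by
  induction B with
  | nil => rfl
  | cons r B ih => simp [bTrim, ih]

/-! ### Positivity certificates

A polynomial in `x⁻¹, y⁻¹` is multiplied by powers of `x` and `y`; then `x = X / Y` and
`y = P / Q + O(ε)` are substituted with polynomials `X, Y, P, Q` in one positive variable, and the
result has non-negative coefficients. -/

def bWidth : List (List ℤ) → ℕ
  | [] => 0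
  | r :: B => max r.length (bWidth B)

def lPad (n : ℕ) (r : List ℤ) : List ℤ := r ++ List.replicate (n - r.length) 0

/-- All rows have length `n`. -/
def bUniform (n : ℕ) : List (List ℤ) → Prop
  | [] => True
  | r :: B => r.length = n ∧ bUniform n B

/-- Reversing each padded row inverts the first variable; the accumulator reverses the order of the
rows and so inverts the second. This turns a polynomial in `U, V` into one in the bounded quantities
`1/U` and `q`. -/
def bPadRev (n : ℕ) : List (List ℤ) → List (List ℤ) → List (List ℤ)
  | [], acc => acc
  | r :: B, acc => bPadRev n B ((lPad n r).reverse :: acc)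

lemma bUniform_bPadRev {n : ℕ} {B acc : List (List ℤ)} (hB : bWidth B ≤ n)
    (hacc : bUniform n acc) : bUniform n (bPadRev n B acc) := by
  induction B generalizing acc with
  | nil => exact hacc
  | cons r B ih =>
    simp only [bWidth, sup_le_iff] at hB
    refine ih hB.2 ⟨?_, hacc⟩
    simp [lPad]; omega

lemma length_bPadRev (n : ℕ) (B acc : List (List ℤ)) :
    (bPadRev n B acc).length = B.length + acc.length := by
  induction B generalizing acc with
  | nil => simp [bPadRev]
  | cons r B ih => simp only [bPadRev, ih, List.length_cons]; omega

lemma bEval_bPadRev {n : ℕ} {B : List (List ℤ)} (hB : bWidth B ≤ n) (acc : List (List ℤ))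
    {x y : ℝ} (hx : x ≠ 0) (hy : y ≠ 0) :
    bEval (bPadRev n B acc) x y * (x * y) =
      x ^ n * y ^ B.length * bEval B x⁻¹ y⁻¹ + y ^ (B.length + 1) * x * bEval acc x y := by
  induction B generalizing acc with
  | nil => simp [bPadRev]; ring
  | cons r B ih =>
    simp only [bWidth, sup_le_iff] at hB
    have h1 := lEval_reverse (lPad n r) hx
    have hl : (lPad n r).length = n := by simp [lPad]; omega
    rw [hl, lPad, lEval_append_replicate] at h1
    simp only [bPadRev, ih hB.2, bEval_cons, List.length_cons]
    have h2 : y ^ (B.length + 1) * x * (lEval (lPad n r).reverse x + y * bEval acc x y) =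
      y ^ (B.length + 1) * (lEval (lPad n r).reverse x * x) + y ^ (B.length + 1) * x * y *
        bEval acc x y := by ring
    rw [h2, lPad, h1]
    field_simp
    ring

/-- `∑ |a|` over a row. -/
def lAbs : List ℤ → ℕ
  | [] => 0
  | a :: l => a.natAbs + lAbs l

/-- A bound for the absolute value on `[0, 1] × [0, 3]`, the range of `(1/U, q)`; the 3 bounds the
second variable. -/
def bAbs : List (List ℤ) → ℕ
  | [] => 0
  | r :: B => lAbs r + 3 * bAbs B

/-- A Lipschitz constant in the second variable on `[0, 1] × [0, 3]`. -/
def bLip : List (List ℤ) → ℕ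
  | [] => 0
  | _ :: B => 3 * bLip B + bAbs B

lemma abs_lEval_le (l : List ℤ) {x : ℝ} (hx : 0 ≤ x) (hx1 : x ≤ 1) : |lEval l x| ≤ lAbs l := by
  induction l with
  | nil => simp [lAbs]
  | cons a l ih =>
    rw [lEval_cons, lAbs]
    push_cast
    refine (abs_add_le _ _).trans ?_
    rw [abs_mul, abs_of_nonneg hx, Nat.cast_natAbs, Int.cast_abs]
    nlinarith [abs_nonneg (lEval l x)]

lemma abs_bEval_le (B : List (List ℤ)) {x y : ℝ} (hx : 0 ≤ x) (hx1 : x ≤ 1) (hy : 0 ≤ y)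
    (hy3 : y ≤ 3) : |bEval B x y| ≤ bAbs B := by
  induction B with
  | nil => simp [bAbs]
  | cons r B ih =>
    rw [bEval_cons, bAbs]
    push_cast
    refine (abs_add_le _ _).trans (add_le_add (abs_lEval_le r hx hx1) ?_)
    rw [abs_mul, abs_of_nonneg hy]
    exact mul_le_mul hy3 ih (abs_nonneg _) (by norm_num)

lemma abs_bEval_sub_le (B : List (List ℤ)) {x y y₀ : ℝ} (hx : 0 ≤ x) (hx1 : x ≤ 1) (hy : 0 ≤ y)
    (hy3 : y ≤ 3) (hy0 : 0 ≤ y₀) (hy03 : y₀ ≤ 3) :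
    |bEval B x y - bEval B x y₀| ≤ bLip B * |y - y₀| := by
  induction B with
  | nil => simp [bLip]
  | cons r B ih =>
    have h : bEval (r :: B) x y - bEval (r :: B) x y₀ =
        y * (bEval B x y - bEval B x y₀) + bEval B x y₀ * (y - y₀) := by
      simp only [bEval_cons]; ring
    rw [h, bLip]
    push_cast
    refine (abs_add_le _ _).trans ?_
    rw [abs_mul, abs_mul, abs_of_nonneg hy]
    have h1 := mul_le_mul hy3 ih (abs_nonneg _) (by norm_num)
    have h2 := mul_le_mul_of_nonneg_right (abs_bEval_le B hx hx1 hy0 hy03) (abs_nonneg (y - y₀))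
    linarith

/-- Homogeneous substitution `x = X / Y` in a row. -/
def lHom (X Y : List ℤ) : List ℤ → List ℤ
  | [] => []
  | a :: l => lAdd (lSmul a (lPow Y l.length)) (lMul X (lHom X Y l))

def bHom (X Y P Q : List ℤ) : List (List ℤ) → List ℤ
  | [] => []
  | r :: B => lAdd (lMul (lPow Q B.length) (lHom X Y r)) (lMul P (bHom X Y P Q B))

lemma lEval_lHom (X Y l : List ℤ) {s : ℝ} (hY : lEval Y s ≠ 0) :
    lEval (lHom X Y l) s * lEval Y s = lEval Y s ^ l.length * lEval l (lEval X s / lEval Y s) := by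
  induction l with
  | nil => simp [lHom]
  | cons a l ih =>
    have h : lEval (lHom X Y (a :: l)) s * lEval Y s = a * lEval Y s ^ l.length * lEval Y s +
        lEval X s * (lEval (lHom X Y l) s * lEval Y s) := by
      simp only [lHom, lEval_lAdd, lEval_lSmul, lEval_lPow, lEval_lMul]; ring
    rw [h, ih, lEval_cons, List.length_cons]
    field_simp
    ring

lemma lEval_bHom (X Y P Q : List ℤ) {n : ℕ} {B : List (List ℤ)} (hB : bUniform n B) {s : ℝ}
    (hY : lEval Y s ≠ 0) (hQ : lEval Q s ≠ 0) :
    lEval (bHom X Y P Q B) s * (lEval Y s * lEval Q s) = lEval Y s ^ n * lEval Q s ^ B.length *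
      bEval B (lEval X s / lEval Y s) (lEval P s / lEval Q s) := by
  induction B with
  | nil => simp [bHom]
  | cons r B ih =>
    have h : lEval (bHom X Y P Q (r :: B)) s * (lEval Y s * lEval Q s) =
        lEval Q s ^ (B.length + 1) * (lEval (lHom X Y r) s * lEval Y s) +
        lEval P s * (lEval (bHom X Y P Q B) s * (lEval Y s * lEval Q s)) := by
      simp only [bHom, lEval_lAdd, lEval_lPow, lEval_lMul]; ring
    rw [h, ih hB.2, lEval_lHom X Y r hY, hB.1, bEval_cons, List.length_cons]
    field_simp
    ring

/-! ### The differential ring of the Liouville variables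

With `U = z² / (z² - 1)`, `V = 1 / q`, where `q = 3 (1 - arcsec z / √(z² - 1))`, one has
`z U' = 2 U - 2 U²`, `z V' = U V - 3 V²`, and `z w' = 2 V w` for `w = -ζ`. -/

/-- For `f = w Uⁱ Vʲ z⁻ⁿ` the rules for `U, V, w` give `z f' = ((2i - n) + (j - 2i) U + (2 - 3j) V)
f`. The first two summands stay in the row of `Vʲ` and are collected here; the third moves to the
next row and is added in `bStepAux`. -/
def stepRow (j n : ℤ) : ℤ → List ℤ → List ℤ
  | _, [] => []
  | i, a :: l => lAdd [(2 * i - n) * a, (j - 2 * i) * a] (0 :: stepRow j n (i + 1) l)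

def bStepAux (n : ℤ) : ℤ → List (List ℤ) → List (List ℤ)
  | _, [] => []
  | j, r :: B => bAdd [stepRow j n 0 r, lSmul (2 - 3 * j) r] ([] :: bStepAux n (j + 1) B)

/-- If `B` represents `f = w * B(U, V) / z ^ n`, then `bStep n B` represents
`f' = w * (bStep n B)(U, V) / z ^ (n + 1)`. -/
def bStep (n : ℤ) (B : List (List ℤ)) : List (List ℤ) := bStepAux n 0 B

def bSteps (n : ℤ) : ℕ → List (List ℤ) → List (List ℤ)
  | 0, B => B
  | k + 1, B => bStep (n + k) (bSteps n k B)

lemma lEval_stepRow (j n i : ℤ) (l : List ℤ) (x : ℝ) :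
    lEval (stepRow j n i l) x =
      (j * x - n + 2 * i * (1 - x)) * lEval l x + 2 * (x - x ^ 2) * lEvalD l x := by
  induction l generalizing i with
  | nil => simp [stepRow, lEvalD]
  | cons a l ih =>
    simp only [stepRow, lEval_lAdd, lEval_cons, ih, lEvalD, lEval_nil]; push_cast; ring

lemma bEval_bStepAux (n j : ℤ) (B : List (List ℤ)) (x y : ℝ) :
    bEval (bStepAux n j B) x y = (j * x - n + 2 * y - 3 * j * y) * bEval B x y +
      2 * (x - x ^ 2) * bEvalX B x y + (x * y - 3 * y ^ 2) * bEvalY B x y := by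
  induction B generalizing j with
  | nil => simp [bStepAux, bEvalX, bEvalY]
  | cons r B ih =>
    simp only [bStepAux, bEval_bAdd, bEval_cons, ih, lEval_stepRow, bEvalX, bEvalY, bEval_nil,
      lEval_nil, lEval_lSmul]
    push_cast
    ring

lemma bEval_bStep (n : ℤ) (B : List (List ℤ)) (x y : ℝ) :
    bEval (bStep n B) x y = (2 * y - n) * bEval B x y +
      2 * (x - x ^ 2) * bEvalX B x y + (x * y - 3 * y ^ 2) * bEvalY B x y := by
  rw [bStep, bEval_bStepAux]; push_cast; ring

/-! ### The coefficient polynomials -/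

def bOne : List (List ℤ) := [[1]]

/-- `Υ₁ = w z⁻² polU1(U, V) / 12`. -/
def polU1 : List (List ℤ) := [[], [0, -2, 5], [0, -5]]

/-- `Υ₂ = w z⁻⁴ polU2(U, V) / 2880`. -/
def polU2 : List (List ℤ) :=
  [[], [0, 0, -16, -1464, 6630, -5525], [0, 0, 20, -100, 125], [0, 0, 400, -1000], [0, 0, 6400]]

/-- `Υ₃ = w z⁻⁶ polU3(U, V) / 1451520`. -/
def polU3 : List (List ℤ) :=
  [[], [0, 0, 0, -2304, 720000, -19877760, 98038080, -156539250, 78269625],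
    [0, 0, 0, 672, 59808, -432180, 928200, -580125], [0, 0, 0, 5600, 623280, -2805600, 2338000],
    [0, 0, 0, -58800, 294000, -367500], [0, 0, 0, -2688000, 6720000], [0, 0, 0, -86380000]]

/-- `ẑ₁ = z⁻¹ polZ1(U, V) / 24`. -/
def polZ1 : List (List ℤ) := [[0, -2, 5], [0, -5]]

/-- `ẑ₂ = -z⁻³ polZ2(U, V) / 5760`. -/
def polZ2 : List (List ℤ) :=
  [[0, 0, -4, 1824, -7755, 6400], [0, 0, -100, 950, -1000], [0, 0, -125, 125], [0, 0, -5525]]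

/-- `ẑ₃ = z⁻⁵ polZ3(U, V) / 2903040`. -/
def polZ3 : List (List ℤ) :=
  [[0, 0, 0, -1912, 919724, -22703506, 109283125, -173163200, 86380000],
    [0, 0, 0, -420, 576240, -5220495, 11218200, -6720000],
    [0, 0, 0, -5250, 165375, -511875, 367500], [0, 0, 0, -236425, 2226350, -2338000],
    [0, 0, 0, -580125, 580125], [0, 0, 0, -78269625]]

/-- At `(U, V)` these four are `zᵏ w⁽ᵏ⁾ / w` and, up to the denominators 12, 2880 and 1451520,
`z^(k+2j) Υⱼ⁽ᵏ⁾ / w`. -/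
def derW (k : ℕ) : List (List ℤ) := bSteps 0 k bOne
def derU1 (k : ℕ) : List (List ℤ) := bSteps 2 k polU1
def derU2 (k : ℕ) : List (List ℤ) := bSteps 4 k polU2
def derU3 (k : ℕ) : List (List ℤ) := bSteps 6 k polU3

/-- The quotient by `padeDen`, in the variable `s = z - 1`, approximates `q` from below. It vanishes
at `s = 0` like `q`, and its limit at infinity is just below 3, the limit of `q`. -/
def padeNum : List ℤ :=
  [0, 946137490683693358050, 5808838749473558213415, 15490878194191671175905,
    23432087949448654195005, 21985209851057993300475, 13099675753496062428225,
    4839889147670041683855, 1013636501947073654187, 92124286260972736771]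

def padeDen : List ℤ :=
  lMul [1, 1] [473068745341846679025, 2762498751134225103000, 7004545095890482440300,
    10071398220531890041800, 8980637524292660376150, 5085108011433555105000,
    1785453241345182028620, 355406902051077796920, 30708095420329712385]

/-- The certificate of positivity of `B(U, V)` for `z > 1`, with a Padé approximant of `q` whose
error is at most `10⁻¹² ((z - 1) / z)¹⁸`. -/
def certPoly (B : List (List ℤ)) : List ℤ :=
  let T := bTrim B
  let n := bWidth T
  let C := bPadRev n T []
  lAdd (lMul (lSmul 1000000000000 (lPow [1, 1] 18)) (bHom [0, 2, 1] [1, 2, 1] padeNum padeDen C))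
    (lSmul (-(bLip C : ℤ)) (lMul (lPow [0, 1] 18)
      (lMul (lPow [1, 2, 1] (n - 1)) (lPow padeDen (C.length - 1)))))

/-- The first two tests make the truncated subtractions in `certPoly` exact. -/
def posCheck (B : List (List ℤ)) : Bool :=
  decide (0 < bWidth (bTrim B)) && decide (0 < (bTrim B).length) && lPosCheck (certPoly B)

/-- The sum of a list of polynomials. -/
def bSum : List (List (List ℤ)) → List (List ℤ)
  | [] => []
  | B :: l => bAdd B (bSum l)

/-- The polynomial of the lower bound for `e`. -/
def polLower : List (List ℤ) :=
  bAdd (bSmul 3630480 (bMul [[0, 1]] (bMul (derW 1) polZ3)))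
    (bMul [[1, -1]] (bSum [
      bSmul (-9697460) (bMul polZ3 (derU1 1)),
      bSmul 4363857 (bMul polZ3 (bMul (derW 2) polZ1)),
      bSmul 210000000 (bMul (derU1 2) (bMul polZ1 polZ2)),
      bSmul 21000000 (bMul (derU2 1) polZ2),
      bSmul (-350000000) (bMul (derU1 3) (bMul polZ1 (bMul polZ1 polZ1))),
      bSmul (-105000000) (bMul (derU2 2) (bMul polZ1 polZ1)),
      bSmul (-10000000) (bMul (derU3 1) polZ1)]))

/-- The polynomial of the upper bound for `e`. -/
def polUpper : List (List ℤ) :=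
  bAdd (bSmul 6251040 (bMul [[0, 1]] (bMul (derW 1) polZ3)))
    (bMul [[1, -1]] (bSum [
      bSmul (-21000000) (bMul (derW 2) (bMul polZ2 polZ2)),
      bSmul (-20260460) (bMul (derW 2) (bMul polZ1 polZ3)),
      bSmul 210000000 (bMul (derW 3) (bMul polZ1 (bMul polZ1 polZ2))),
      bSmul (-175000000) (bMul (derW 4) (bMul (bMul polZ1 polZ1) (bMul polZ1 polZ1)))]))

/-! ### Kernel-checked signs, comparisons and reversion identities -/

set_option maxRecDepth 100000

theorem posCheck_neg_derW_two : posCheck (bSmul (-1) (derW 2)) = true := by decide +kernel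
theorem posCheck_derW_three : posCheck (derW 3) = true := by decide +kernel
theorem posCheck_neg_derW_four : posCheck (bSmul (-1) (derW 4)) = true := by decide +kernel
theorem posCheck_derW_five : posCheck (derW 5) = true := by decide +kernel
theorem posCheck_neg_derU1_one : posCheck (bSmul (-1) (derU1 1)) = true := by decide +kernel
theorem posCheck_derU1_two : posCheck (derU1 2) = true := by decide +kernel
theorem posCheck_neg_derU1_three : posCheck (bSmul (-1) (derU1 3)) = true := by decide +kernel
theorem posCheck_derU1_four : posCheck (derU1 4) = true := by decide +kernel
theorem posCheck_derU2_one : posCheck (derU2 1) = true := by decide +kernel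
theorem posCheck_neg_derU2_two : posCheck (bSmul (-1) (derU2 2)) = true := by decide +kernel
theorem posCheck_derU2_three : posCheck (derU2 3) = true := by decide +kernel
theorem posCheck_neg_derU3_one : posCheck (bSmul (-1) (derU3 1)) = true := by decide +kernel
theorem posCheck_derU3_two : posCheck (derU3 2) = true := by decide +kernel
theorem posCheck_polZ1 : posCheck polZ1 = true := by decide +kernel
theorem posCheck_polZ2 : posCheck polZ2 = true := by decide +kernel
theorem posCheck_polZ3 : posCheck polZ3 = true := by decide +kernel
theorem posCheck_polZ2_sub_polZ3 :
    posCheck (bAdd (bSmul 504000000 (bMul [[0, 1]] polZ2))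
      (bSmul 1013023 (bMul [[1, -1]] polZ3))) = true := by decide +kernel
theorem posCheck_polZ1_sub_polZ2 :
    posCheck (bAdd (bSmul 24 (bMul [[0, 1]] polZ1)) (bMul [[1, -1]] polZ2)) = true := by
  decide +kernel
theorem posCheck_derW_sub_derU2 :
    posCheck (bAdd (bSmul 2880 (bMul [[0, 0, 1]] (derW 1)))
      (bSmul (-1) (bMul [[1, -2, 1]] (derU2 1)))) = true := by decide +kernel
theorem posCheck_polLower : posCheck polLower = true := by decide +kernel
theorem posCheck_polUpper : posCheck polUpper = true := by decide +kernel

/-- `z ẑ₁ w' = w Υ₁` -/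
theorem bZero_first_order :
    bZero (bAdd (bMul (derW 1) polZ1) (bSmul (-2) polU1)) = true := by decide +kernel

/-- Order `e²` of the reversion: `ẑ₂ w' + ẑ₁² w''/2 - ẑ₁ Υ₁' - Υ₂ = 0`, with denominators cleared.
-/
theorem bZero_second_order :
    bZero (bSum [bSmul (-2) (bMul (derW 1) polZ2), bSmul 10 (bMul (derW 2) (bMul polZ1 polZ1)),
      bSmul (-40) (bMul (derU1 1) polZ1), bSmul (-4) polU2]) = true := by decide +kernel

/-- Order `e³`: `ẑ₃ w' + ẑ₁ ẑ₂ w'' + ẑ₁³ w'''/6 - ẑ₂ Υ₁' - ẑ₁² Υ₁''/2 - ẑ₁ Υ₂' - Υ₃ = 0`. -/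
theorem bZero_third_order :
    bZero (bSum [bSmul 120 (bMul (derW 1) polZ3), bSmul (-2520) (bMul (derW 2) (bMul polZ1 polZ2)),
      bSmul 4200 (bMul (derW 3) (bMul polZ1 (bMul polZ1 polZ1))),
      bSmul 5040 (bMul (derU1 1) polZ2), bSmul (-25200) (bMul (derU1 2) (bMul polZ1 polZ1)),
      bSmul (-5040) (bMul (derU2 1) polZ1), bSmul (-240) polU3]) = true := by decide +kernel

/-! ### The Liouville variables as functions of `z` -/

noncomputable def secTan (z : ℝ) : ℝ := Real.sqrt (z ^ 2 - 1)

noncomputable def qFun (z : ℝ) : ℝ := 3 * (1 - Real.arccos (1 / z) / secTan z)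

noncomputable def uFun (z : ℝ) : ℝ := z ^ 2 / (z ^ 2 - 1)

noncomputable def vFun (z : ℝ) : ℝ := (qFun z)⁻¹

noncomputable def wFun (z : ℝ) : ℝ := -zeta z

lemma sq_sub_one_pos {z : ℝ} (hz : 1 < z) : 0 < z ^ 2 - 1 := by nlinarith

lemma secTan_pos {z : ℝ} (hz : 1 < z) : 0 < secTan z := Real.sqrt_pos.2 (sq_sub_one_pos hz)

lemma secTan_sq {z : ℝ} (hz : 1 < z) : secTan z ^ 2 = z ^ 2 - 1 :=
  Real.sq_sqrt (sq_sub_one_pos hz).le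

lemma hasDerivAt_secTan {z : ℝ} (hz : 1 < z) : HasDerivAt secTan (z / secTan z) z := by
  have h : HasDerivAt (fun z : ℝ => z ^ 2 - 1) (2 * z) z := by
    simpa using (hasDerivAt_pow 2 z).sub_const 1
  have := h.sqrt (sq_sub_one_pos hz).ne'
  refine this.congr_deriv ?_
  rw [secTan, mul_div_mul_left _ _ two_ne_zero]

lemma hasDerivAt_arcsec {z : ℝ} (hz : 1 < z) :
    HasDerivAt (fun z : ℝ => Real.arccos (1 / z)) (1 / (z * secTan z)) z := by
  have hz0 : 0 < z := by linarith
  have h1 : HasDerivAt (fun z : ℝ => 1 / z) (-(z ^ 2)⁻¹) z := by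
    simpa using hasDerivAt_inv hz0.ne'
  have hlt : 1 / z < 1 := by rw [div_lt_one hz0]; exact hz
  have hgt : -1 < 1 / z := lt_trans (by norm_num) (by positivity : 0 < 1 / z)
  have h2 := (Real.hasDerivAt_arccos hgt.ne' hlt.ne).comp z h1
  refine h2.congr_deriv ?_
  have h3 : Real.sqrt (1 - (1 / z) ^ 2) = secTan z / z := by
    rw [secTan, ← Real.sqrt_sq hz0.le, ← Real.sqrt_div' _ (by positivity), Real.sqrt_sq hz0.le]
    congr 1
    field_simp
  rw [h3]
  have := secTan_pos hz
  field_simp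

lemma continuous_arcsec_on : ContinuousOn (fun z : ℝ => Real.arccos (1 / z)) (Set.Ici 1) := by
  refine Real.continuous_arccos.comp_continuousOn ?_
  exact continuousOn_const.div continuousOn_id fun z hz => by
    have : (1 : ℝ) ≤ z := hz
    show z ≠ 0
    linarith

lemma continuous_secTan : Continuous secTan := by unfold secTan; fun_prop

/-! ### Rational bounds for `q` and soundness of the positivity check -/

/-- `3 z √(z² - 1) Q²` times the derivative of `√(z² - 1) (1 - P / (3 Q)) - arcsec z`. -/
def residPoly (P Q : List ℤ) : List ℤ :=
  lAdd (lMul [0, 6, 3] (lMul Q Q)) (lAdd (lSmul (-1) (lMul [1, 2, 1] (lMul P Q)))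
    (lSmul (-1) (lMul [0, 2, 3, 1]
      (lAdd (lMul (lDeriv P) Q) (lSmul (-1) (lMul P (lDeriv Q)))))))

/-- Its sign tells on which side of `q` the fraction `P/Q` lies. It vanishes at 1 and its derivative
contains no `arcsec`, so coefficients of one sign in `residPoly P Q` settle the comparison for every
`z > 1`. -/
noncomputable def padeDiff (P Q : List ℤ) (z : ℝ) : ℝ :=
  secTan z * (1 - lEval P (z - 1) / (3 * lEval Q (z - 1))) - Real.arccos (1 / z)

lemma hasDerivAt_padeDiff (P Q : List ℤ) {z : ℝ} (hz : 1 < z) (hQ : 0 < lEval Q (z - 1)) :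
    HasDerivAt (padeDiff P Q)
      (lEval (residPoly P Q) (z - 1) / (3 * z * secTan z * lEval Q (z - 1) ^ 2)) z := by
  have hP' : HasDerivAt (fun z : ℝ => lEval P (z - 1)) (lEvalD P (z - 1)) z :=
    (hasDerivAt_lEval P (z - 1)).comp_sub_const z 1
  have hQ' : HasDerivAt (fun z : ℝ => lEval Q (z - 1)) (lEvalD Q (z - 1)) z :=
    (hasDerivAt_lEval Q (z - 1)).comp_sub_const z 1
  have hPQ : HasDerivAt (fun z : ℝ => lEval P (z - 1) / (3 * lEval Q (z - 1)))
      ((lEvalD P (z - 1) * (3 * lEval Q (z - 1)) - lEval P (z - 1) * (3 * lEvalD Q (z - 1))) /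
        (3 * lEval Q (z - 1)) ^ 2) z :=
    hP'.div (hQ'.const_mul 3) (by positivity)
  refine (((hasDerivAt_secTan hz).mul (hPQ.const_sub 1)).sub
    (hasDerivAt_arcsec hz)).congr_deriv ?_
  clear hPQ hP' hQ'
  have hT := secTan_pos hz
  have hT2 := secTan_sq hz
  have hz0 : 0 < z := by linarith
  simp only [residPoly, lEval_lAdd, lEval_lSmul, lEval_lMul, lEval_cons, lEval_nil, lEval_lDeriv]
  generalize lEval P (z - 1) = p at *
  generalize lEval Q (z - 1) = r at *
  generalize lEvalD P (z - 1) = p' at *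
  generalize lEvalD Q (z - 1) = r' at *
  push_cast
  field_simp
  rw [hT2]
  ring

lemma continuousOn_padeDiff (P Q : List ℤ) (hQ : ∀ s : ℝ, 0 ≤ s → 0 < lEval Q s) :
    ContinuousOn (padeDiff P Q) (Set.Ici 1) := by
  have hc : ∀ l : List ℤ, Continuous fun z : ℝ => lEval l (z - 1) := fun l =>
    (continuous_iff_continuousAt.2 fun x => (hasDerivAt_lEval l x).continuousAt).comp
      (continuous_id.sub continuous_const)
  refine (continuous_secTan.continuousOn.mul (continuousOn_const.sub
    ((hc P).continuousOn.div (continuousOn_const.mul (hc Q).continuousOn) fun z hz => ?_))).sub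
    continuous_arcsec_on
  have := hQ (z - 1) (sub_nonneg.2 hz)
  exact (mul_pos three_pos this).ne'

lemma padeDiff_one (P Q : List ℤ) : padeDiff P Q 1 = 0 := by simp [padeDiff, secTan]

lemma padeDiff_nonneg {P Q : List ℤ} (hQ : ∀ s : ℝ, 0 ≤ s → 0 < lEval Q s)
    (h : lNonneg (residPoly P Q) = true) {z : ℝ} (hz : 1 < z) : 0 ≤ padeDiff P Q z := by
  have hm : MonotoneOn (padeDiff P Q) (Set.Ici 1) := by
    refine monotoneOn_of_deriv_nonneg (convex_Ici 1) (continuousOn_padeDiff P Q hQ) ?_ ?_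
    · rw [interior_Ici]
      exact fun x hx => (hasDerivAt_padeDiff P Q hx
        (hQ _ (sub_pos.2 hx).le)).differentiableAt.differentiableWithinAt
    · rw [interior_Ici]
      intro x hx
      have hx : 1 < x := hx
      have hx0 : 0 < x := by linarith
      rw [(hasDerivAt_padeDiff P Q hx (hQ _ (sub_pos.2 hx).le)).deriv]
      have := secTan_pos hx
      have := lEval_nonneg h (sub_pos.2 hx).le
      positivity
  have := hm (Set.mem_Ici.2 le_rfl) (Set.mem_Ici.2 hz.le) hz.le
  rwa [padeDiff_one] at this

lemma padeDiff_nonpos {P Q : List ℤ} (hQ : ∀ s : ℝ, 0 ≤ s → 0 < lEval Q s)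
    (h : lNonneg (lSmul (-1) (residPoly P Q)) = true) {z : ℝ} (hz : 1 < z) :
    padeDiff P Q z ≤ 0 := by
  have hm : AntitoneOn (padeDiff P Q) (Set.Ici 1) := by
    refine antitoneOn_of_deriv_nonpos (convex_Ici 1) (continuousOn_padeDiff P Q hQ) ?_ ?_
    · rw [interior_Ici]
      exact fun x hx => (hasDerivAt_padeDiff P Q hx
        (hQ _ (sub_pos.2 hx).le)).differentiableAt.differentiableWithinAt
    · rw [interior_Ici]
      intro x hx
      have hx : 1 < x := hx
      have hx0 : 0 < x := by linarith
      rw [(hasDerivAt_padeDiff P Q hx (hQ _ (sub_pos.2 hx).le)).deriv]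
      have := secTan_pos hx
      have h1 := lEval_nonneg h (sub_pos.2 hx).le
      rw [lEval_lSmul] at h1
      refine div_nonpos_of_nonpos_of_nonneg ?_ (by positivity)
      push_cast at h1
      linarith
  have := hm (Set.mem_Ici.2 le_rfl) (Set.mem_Ici.2 hz.le) hz.le
  rwa [padeDiff_one] at this

/-- Numerator and denominator of the upper bound `padeNum/padeDen + 10⁻¹² (s/(1 + s))¹⁸`. -/
def padeUpperNum : List ℤ :=
  lAdd (lSmul 1000000000000 (lMul (lPow [1, 1] 18) padeNum)) (lMul (lPow [0, 1] 18) padeDen)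

def padeUpperDen : List ℤ := lSmul 1000000000000 (lMul (lPow [1, 1] 18) padeDen)

theorem lNonneg_residPoly_lower : lNonneg (residPoly padeNum padeDen) = true := by decide +kernel

theorem lNonneg_residPoly_upper :
    lNonneg (lSmul (-1) (residPoly padeUpperNum padeUpperDen)) = true := by decide +kernel

lemma padeNum_nonneg {s : ℝ} (hs : 0 ≤ s) : 0 ≤ lEval padeNum s :=
  lEval_nonneg (by decide +kernel) hs

lemma padeNum_pos {s : ℝ} (hs : 0 < s) : 0 < lEval padeNum s :=
  lEval_pos (by decide +kernel) hs

lemma padeDen_pos {s : ℝ} (hs : 0 ≤ s) : 0 < lEval padeDen s := by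
  simp only [padeDen, lEval_lMul, lEval_cons, lEval_nil]
  push_cast
  positivity

lemma padeUpperDen_pos {s : ℝ} (hs : 0 ≤ s) : 0 < lEval padeUpperDen s := by
  have := padeDen_pos hs
  simp only [padeUpperDen, lEval_lMul, lEval_lSmul, lEval_lPow, lEval_cons, lEval_nil]
  push_cast
  positivity

lemma pade_le_qFun {z : ℝ} (hz : 1 < z) :
    lEval padeNum (z - 1) / lEval padeDen (z - 1) ≤ qFun z := by
  have h := padeDiff_nonneg (fun s hs => padeDen_pos hs) lNonneg_residPoly_lower hz
  have hT := secTan_pos hz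
  have hQ := padeDen_pos (sub_pos.2 hz).le
  rw [padeDiff, sub_nonneg, ← div_le_iff₀' hT] at h
  have h2 : lEval padeNum (z - 1) / (3 * lEval padeDen (z - 1)) =
    lEval padeNum (z - 1) / lEval padeDen (z - 1) / 3 := by field_simp
  rw [h2] at h
  rw [qFun]; linarith

lemma qFun_le_pade {z : ℝ} (hz : 1 < z) :
    qFun z ≤ lEval padeNum (z - 1) / lEval padeDen (z - 1) +
      ((z - 1) / z) ^ 18 / 1000000000000 := by
  have h := padeDiff_nonpos (fun s hs => padeUpperDen_pos hs) lNonneg_residPoly_upper hz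
  have hT := secTan_pos hz
  have hQ := padeDen_pos (sub_pos.2 hz).le
  have hz0 : 0 < z := by linarith
  rw [padeDiff, sub_nonpos, ← le_div_iff₀' hT] at h
  have h2 : lEval padeUpperNum (z - 1) / (3 * lEval padeUpperDen (z - 1)) =
    (lEval padeNum (z - 1) / lEval padeDen (z - 1) + ((z - 1) / z) ^ 18 / 1000000000000) / 3 := by
    simp only [padeUpperNum, padeUpperDen, lEval_lAdd, lEval_lMul, lEval_lSmul, lEval_lPow,
      lEval_cons, lEval_nil]
    generalize lEval padeNum (z - 1) = p at *
    generalize lEval padeDen (z - 1) = r at *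
    push_cast
    have e1 : (1 + (z - 1) * (1 + (z - 1) * 0)) = z := by ring
    have e2 : (0 + (z - 1) * (1 + (z - 1) * 0)) = z - 1 := by ring
    rw [e1, e2]
    field_simp
  rw [h2] at h
  rw [qFun]; linarith

lemma qFun_pos {z : ℝ} (hz : 1 < z) : 0 < qFun z :=
  lt_of_lt_of_le (div_pos (padeNum_pos (sub_pos.2 hz)) (padeDen_pos (sub_pos.2 hz).le))
    (pade_le_qFun hz)

lemma qFun_le_three {z : ℝ} (hz : 1 < z) : qFun z ≤ 3 := by
  have := div_nonneg (Real.arccos_nonneg (1 / z)) (secTan_pos hz).le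
  rw [qFun]; linarith

/-- With `u = 1/U ∈ (0, 1]`, `B(U, V)` is a positive multiple of `C(u, q)`. Writing `p` for the
rational approximant, `C(u, q) ≥ C(u, p) - bLip C * |q - p|`, and `certPoly` is this lower bound
with the worst error inserted and all denominators cleared, a polynomial in `s = z - 1`. -/
theorem bEval_pos_of_posCheck {B : List (List ℤ)} (h : posCheck B = true) {z : ℝ} (hz : 1 < z) :
    0 < bEval B (uFun z) (vFun z) := by
  obtain ⟨s, rfl⟩ : ∃ s, z = s + 1 := ⟨z - 1, by ring⟩
  have hs : 0 < s := by linarith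
  simp only [posCheck, Bool.and_eq_true, decide_eq_true_eq] at h
  obtain ⟨⟨hn, hlen⟩, hpos⟩ := h
  have hc := lEval_pos hpos hs
  simp only [certPoly] at hc
  rw [← bEval_bTrim]
  generalize hT : bTrim B = T at *
  set n := bWidth T with hn'
  set C := bPadRev n T [] with hC
  have hlC : C.length = T.length := by rw [hC, length_bPadRev]; simp
  have hU : bUniform n C := bUniform_bPadRev le_rfl trivial
  set u : ℝ := (uFun (s + 1))⁻¹ with hu
  have hue : u = (s * (s + 2)) / (s + 1) ^ 2 := by
    rw [hu, uFun, inv_div]; congr 1; ring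
  have hu0 : 0 < u := by rw [hue]; positivity
  have hu1 : u ≤ 1 := by rw [hue, div_le_one (by positivity)]; nlinarith
  have hq0 := qFun_pos hz
  have hq3 := qFun_le_three hz
  have hlow := pade_le_qFun hz
  have hupp := qFun_le_pade hz
  simp only [add_sub_cancel_right] at hlow hupp
  set q := qFun (s + 1)
  have hP0 := padeNum_nonneg hs.le
  have hQ0 := padeDen_pos hs.le
  set p := lEval padeNum s / lEval padeDen s with hp
  have hp0 : 0 ≤ p := by positivity
  have c1 := bEval_bPadRev (n := n) (le_refl (bWidth T)) [] hu0.ne' hq0.ne'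
  simp only [bEval_nil, mul_zero, add_zero] at c1
  have hX : lEval [0, 2, 1] s = s * (s + 2) := by
    simp only [lEval_cons, lEval_nil]; push_cast; ring
  have hY : lEval [1, 2, 1] s = (s + 1) ^ 2 := by
    simp only [lEval_cons, lEval_nil]; push_cast; ring
  have c2 := lEval_bHom [0, 2, 1] [1, 2, 1] padeNum padeDen hU (s := s)
    (by rw [hY]; positivity) hQ0.ne'
  rw [hX, hY, ← hue, ← hp] at c2
  have c3 := abs_bEval_sub_le C hu0.le hu1 hq0.le hq3 hp0 (hlow.trans hq3)
  have hqp : |q - p| ≤ (s / (s + 1)) ^ 18 / 1000000000000 := by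
    rw [abs_of_nonneg (by linarith)]; linarith
  have c4 := (abs_le.1 (c3.trans (mul_le_mul_of_nonneg_left hqp (Nat.cast_nonneg _)))).1
  have e1 : lEval [1, 1] s = s + 1 := by simp; ring
  have e2 : lEval [0, 1] s = s := by simp
  simp only [lEval_lAdd, lEval_lMul, lEval_lSmul, lEval_lPow, e1, e2, hY] at hc
  -- Successor forms for both exponents, so that the spare factor in `lEval_bHom` can be cancelled.
  obtain ⟨n', hn1⟩ : ∃ n', n = n' + 1 := ⟨n - 1, by omega⟩
  obtain ⟨l', hl1⟩ : ∃ l', C.length = l' + 1 := ⟨C.length - 1, by omega⟩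
  rw [hn1, hl1] at c2
  rw [hn1, hl1] at hc
  simp only [add_tsub_cancel_right] at hc
  have hpos2 : 0 < bEval C u q := by
    set Q := lEval padeDen s
    set H := lEval (bHom [0, 2, 1] [1, 2, 1] padeNum padeDen C) s
    have hH : H = ((s + 1) ^ 2) ^ n' * Q ^ l' * bEval C u p := by
      have hne : (s + 1) ^ 2 * Q ≠ 0 := by positivity
      apply mul_right_cancel₀ hne
      rw [c2]; ring
    rw [hH] at hc
    have hfac : 0 < ((s + 1) ^ 2) ^ n' * Q ^ l' := by positivity
    have hc' : 0 < (((s + 1) ^ 2) ^ n' * Q ^ l') *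
        (1000000000000 * (s + 1) ^ 18 * bEval C u p - bLip C * s ^ 18) := by
      push_cast at hc
      linarith
    have hc2 := pos_of_mul_pos_right hc' hfac.le
    have h5 : (bLip C : ℝ) * ((s / (s + 1)) ^ 18 / 1000000000000) < bEval C u p := by
      rw [div_pow, div_div, ← mul_div_assoc, div_lt_iff₀ (by positivity)]
      linarith
    linarith
  have : 0 < u ^ n * q ^ T.length * bEval T u⁻¹ q⁻¹ := by rw [← c1]; positivity
  have := pos_of_mul_pos_right this (by positivity)
  rwa [hu, inv_inv] at this

/-! ### Differentiation rules for `U`, `q`, `V` and `w` -/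

lemma uFun_pos {z : ℝ} (hz : 1 < z) : 0 < uFun z := by
  have := sq_sub_one_pos hz
  unfold uFun; positivity

lemma vFun_pos {z : ℝ} (hz : 1 < z) : 0 < vFun z := inv_pos.2 (qFun_pos hz)

lemma one_sub_inv_uFun {z : ℝ} (hz : 1 < z) : uFun z - 1 = uFun z / z ^ 2 := by
  have := sq_sub_one_pos hz
  have hz0 : 0 < z := by linarith
  unfold uFun
  field_simp
  ring

lemma hasDerivAt_uFun {z : ℝ} (hz : 1 < z) :
    HasDerivAt uFun ((2 * uFun z - 2 * uFun z ^ 2) / z) z := by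
  have h0 := sq_sub_one_pos hz
  have hz0 : 0 < z := by linarith
  have h1 : HasDerivAt (fun z : ℝ => z ^ 2) (2 * z) z := by simpa using hasDerivAt_pow 2 z
  refine (h1.div (h1.sub_const 1) h0.ne').congr_deriv ?_
  unfold uFun
  field_simp

lemma hasDerivAt_qFun {z : ℝ} (hz : 1 < z) :
    HasDerivAt qFun ((3 - qFun z * uFun z) / z) z := by
  have h0 := sq_sub_one_pos hz
  have hz0 : 0 < z := by linarith
  have hT := secTan_pos hz
  have hT2 := secTan_sq hz
  refine ((((hasDerivAt_arcsec hz).div (hasDerivAt_secTan hz) hT.ne').const_sub 1).const_mul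
    3).congr_deriv ?_
  unfold uFun qFun
  rw [← hT2]
  generalize Real.arccos (1 / z) = t
  have hz2 : z ^ 2 = secTan z ^ 2 + 1 := by rw [hT2]; ring
  field_simp
  rw [hz2]
  ring

lemma hasDerivAt_vFun {z : ℝ} (hz : 1 < z) :
    HasDerivAt vFun ((uFun z * vFun z - 3 * vFun z ^ 2) / z) z := by
  have hq := qFun_pos hz
  have hz0 : 0 < z := by linarith
  refine ((hasDerivAt_qFun hz).inv hq.ne').congr_deriv ?_
  unfold vFun
  field_simp
  ring

lemma qFun_eq {z : ℝ} (hz : 1 < z) :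
    secTan z - Real.arccos (1 / z) = secTan z * qFun z / 3 := by
  have hT := secTan_pos hz
  unfold qFun
  field_simp

lemma wFun_eq {z : ℝ} (hz : 1 < z) : wFun z = (secTan z * qFun z / 2) ^ (2 / 3 : ℝ) := by
  rw [wFun, zeta, neg_neg]
  congr 1
  have := qFun_eq hz
  rw [secTan] at this ⊢
  rw [this]; ring

lemma wFun_pos {z : ℝ} (hz : 1 < z) : 0 < wFun z := by
  have := secTan_pos hz
  have := qFun_pos hz
  rw [wFun_eq hz]; positivity

lemma wFun_cube {z : ℝ} (hz : 1 < z) : wFun z ^ 3 = (z ^ 2 - 1) * qFun z ^ 2 / 4 := by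
  have := secTan_pos hz
  have := qFun_pos hz
  rw [wFun_eq hz, ← Real.rpow_natCast, ← Real.rpow_mul (by positivity), ← secTan_sq hz]
  norm_num
  ring

lemma hasDerivAt_wFun {z : ℝ} (hz : 1 < z) :
    HasDerivAt wFun (2 * vFun z * wFun z / z) z := by
  have hT := secTan_pos hz
  have hT2 := secTan_sq hz
  have hq := qFun_pos hz
  have hz0 : 0 < z := by linarith
  have hX : 0 < 3 / 2 * (secTan z - Real.arccos (1 / z)) := by
    rw [qFun_eq hz]; positivity
  have h1 := (((hasDerivAt_secTan hz).sub (hasDerivAt_arcsec hz)).const_mul (3 / 2)).rpow_const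
    (p := 2 / 3) (Or.inl hX.ne')
  have hw : wFun = fun z => (3 / 2 * (secTan z - Real.arccos (1 / z))) ^ (2 / 3 : ℝ) := by
    funext z; simp [wFun, zeta, secTan]
  rw [hw]
  refine h1.congr_deriv ?_
  simp only [Pi.sub_apply]
  rw [Real.rpow_sub_one hX.ne']
  have hX2 := qFun_eq hz
  rw [hX2]
  unfold vFun
  have hpos : 0 < (3 / 2 * (secTan z * qFun z / 3)) ^ (2 / 3 : ℝ) := by positivity
  generalize (3 / 2 * (secTan z * qFun z / 3)) ^ (2 / 3 : ℝ) = Y at *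
  have hz2 : z ^ 2 = secTan z ^ 2 + 1 := by rw [hT2]; ring
  field_simp
  rw [hz2]
  ring

/-! ### The coefficient functions in terms of the Liouville variables -/

/-- The function `w * B(U, V) / z ^ n`. -/
noncomputable def wRep (n : ℕ) (B : List (List ℤ)) (z : ℝ) : ℝ :=
  wFun z * bEval B (uFun z) (vFun z) / z ^ n

lemma hasDerivAt_wRep (n : ℕ) (B : List (List ℤ)) {z : ℝ} (hz : 1 < z) :
    HasDerivAt (wRep n B) (wRep (n + 1) (bStep n B) z) z := by
  have hz0 : 0 < z := by linarith
  have h := ((hasDerivAt_wFun hz).mul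
    (hasDerivAt_bEval B (hasDerivAt_uFun hz) (hasDerivAt_vFun hz))).div (hasDerivAt_pow n z)
    (by positivity)
  refine h.congr_deriv ?_
  rw [wRep, bEval_bStep]
  -- The derivative of `zⁿ` involves the truncated exponent `n - 1`.
  rcases n with _ | n
  · simp only [Pi.mul_apply]
    push_cast
    field_simp
    ring
  · simp only [Nat.add_sub_cancel, Pi.mul_apply]
    push_cast
    field_simp
    ring

lemma hasDerivAt_wRep_bSteps (n k : ℕ) (B : List (List ℤ)) {z : ℝ} (hz : 1 < z) :
    HasDerivAt (wRep (n + k) (bSteps n k B)) (wRep (n + (k + 1)) (bSteps n (k + 1) B) z) z := by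
  have := hasDerivAt_wRep (n + k) (bSteps n k B) hz
  rw [bSteps]
  exact_mod_cast this

lemma wRep_pos (n : ℕ) {B : List (List ℤ)} (h : posCheck B = true) {z : ℝ} (hz : 1 < z) :
    0 < wRep n B z := by
  have := wFun_pos hz
  have := bEval_pos_of_posCheck h hz
  have hz0 : 0 < z := by linarith
  unfold wRep; positivity

lemma wRep_neg (n : ℕ) {B : List (List ℤ)} (h : posCheck (bSmul (-1) B) = true) {z : ℝ}
    (hz : 1 < z) : wRep n B z < 0 := by
  have h1 := wRep_pos n h hz
  rw [wRep, bEval_bSmul] at h1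
  rw [wRep]
  have : wFun z * (((-1 : ℤ) : ℝ) * bEval B (uFun z) (vFun z)) / z ^ n =
    -(wFun z * bEval B (uFun z) (vFun z) / z ^ n) := by push_cast; ring
  linarith

/-- Since `σ² = w/(z² - 1)` and `w³ = (z² - 1) q²/4`, both sides are positive with equal squares. -/
lemma sigma_mul_wFun {z : ℝ} (hz : 1 < z) : sigma z * wFun z = qFun z / 2 := by
  have h0 := sq_sub_one_pos hz
  have hw := wFun_pos hz
  have hq := qFun_pos hz
  have h1 : zeta z / (1 - z ^ 2) = wFun z / (z ^ 2 - 1) := by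
    rw [wFun, neg_div, ← div_neg, neg_sub]
  have h2 : wFun z / (z ^ 2 - 1) = (qFun z / (2 * wFun z)) ^ 2 := by
    have := wFun_cube hz
    field_simp
    linarith
  rw [sigma, h1, h2, Real.sqrt_sq (by positivity)]
  field_simp

lemma sigma_mul_zeta {z : ℝ} (hz : 1 < z) : sigma z * zeta z = -(qFun z / 2) := by
  rw [← sigma_mul_wFun hz, wFun]; ring

lemma zeta_cube {z : ℝ} (hz : 1 < z) : zeta z ^ 3 = -((z ^ 2 - 1) * qFun z ^ 2 / 4) := by
  rw [← wFun_cube hz, wFun]; ring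

lemma sigma_cube {z : ℝ} (hz : 1 < z) : sigma z ^ 3 = qFun z / (2 * (z ^ 2 - 1)) := by
  have h0 := sq_sub_one_pos hz
  have hq := qFun_pos hz
  have h1 := zeta_cube hz
  have h2 : (sigma z * zeta z) ^ 3 = (-(qFun z / 2)) ^ 3 := by rw [sigma_mul_zeta hz]
  rw [mul_pow, h1] at h2
  field_simp at h2 ⊢
  linarith

lemma zeta_ne_zero {z : ℝ} (hz : 1 < z) : zeta z ≠ 0 := by
  have := wFun_pos hz
  rw [wFun] at this
  intro h; rw [h] at this; simp at this

lemma upsilon1_eq {z : ℝ} (hz : 1 < z) : upsilon1 z = wRep 2 polU1 z / 12 := by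
  have h0 := sq_sub_one_pos hz
  have hq := qFun_pos hz
  have hz0 : 0 < z := by linarith
  have hne := zeta_ne_zero hz
  -- In every monomial `σⁱ ζʲ` of the coefficient functions 3 divides `i - j`. Hence the braces
  -- depend only on `σ³`, `σζ` and `ζ³`, which are rational in `z²` and `q`; no fractional powers
  -- survive except the factor `ζ` in front. The later formulas are regrouped in the same way.
  have e : upsilon1 z = zeta z / (48 * zeta z ^ 3) *
      (10 * sigma z ^ 3 - 6 * (sigma z * zeta z) - 5) := by
    simp only [upsilon1]; field_simp
  rw [e, zeta_cube hz, sigma_cube hz, sigma_mul_zeta hz, wRep, wFun]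
  clear e
  simp only [polU1, bEval_cons, bEval_nil, lEval_cons, lEval_nil, uFun, vFun]
  generalize zeta z = w
  generalize qFun z = q at *
  obtain ⟨y, hy⟩ : ∃ y, y = z ^ 2 - 1 := ⟨_, rfl⟩
  have hz2 : z ^ 2 = y + 1 := by rw [hy]; ring
  have hy0 : 0 < y := by rw [hy]; exact h0
  simp only [hz2, add_sub_cancel_right]
  push_cast
  field_simp
  ring

lemma upsilon2_eq {z : ℝ} (hz : 1 < z) : upsilon2 z = wRep 4 polU2 z / 2880 := by
  have h0 := sq_sub_one_pos hz
  have hq := qFun_pos hz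
  have hz0 : 0 < z := by linarith
  have hne := zeta_ne_zero hz
  have e : upsilon2 z = zeta z / (11520 * (zeta z ^ 3) ^ 2) *
      (11050 * (sigma z ^ 3) ^ 3 - 19890 * (sigma z ^ 3) ^ 2 * (sigma z * zeta z)
      + 9558 * sigma z ^ 3 * (sigma z * zeta z) ^ 2 - 125 * (sigma z ^ 3) ^ 2
      + 150 * sigma z ^ 3 * (sigma z * zeta z) - 45 * (sigma z * zeta z) ^ 2
      - 750 * (sigma z * zeta z) ^ 3 + 500 * sigma z ^ 3 - 300 * (sigma z * zeta z) - 1600) := by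
    simp only [upsilon2]; field_simp; ring
  rw [e, zeta_cube hz, sigma_cube hz, sigma_mul_zeta hz, wRep, wFun]
  clear e
  simp only [polU2, bEval_cons, bEval_nil, lEval_cons, lEval_nil, uFun, vFun]
  generalize zeta z = w
  generalize qFun z = q at *
  obtain ⟨y, hy⟩ : ∃ y, y = z ^ 2 - 1 := ⟨_, rfl⟩
  have hz2 : z ^ 2 = y + 1 := by rw [hy]; ring
  have hz4 : z ^ 4 = (y + 1) ^ 2 := by rw [← hz2]; ring
  have hy0 : 0 < y := by rw [hy]; exact h0
  simp only [hz4, hz2, add_sub_cancel_right]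
  push_cast
  field_simp
  ring

lemma upsilon3_eq {z : ℝ} (hz : 1 < z) : upsilon3 z = wRep 6 polU3 z / 1451520 := by
  have h0 := sq_sub_one_pos hz
  have hq := qFun_pos hz
  have hz0 : 0 < z := by linarith
  have hne := zeta_ne_zero hz
  have e : upsilon3 z = zeta z / (5806080 * (zeta z ^ 3) ^ 3) *
      (156539250 * (sigma z ^ 3) ^ 5 - 469617750 * (sigma z ^ 3) ^ 4 * (sigma z * zeta z)
      + 509154660 * (sigma z ^ 3) ^ 3 * (sigma z * zeta z) ^ 2 - 580125 * (sigma z ^ 3) ^ 4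
      + 1392300 * (sigma z ^ 3) ^ 3 * (sigma z * zeta z)
      - 1128330 * (sigma z ^ 3) ^ 2 * (sigma z * zeta z) ^ 2
      - 140 * (1681389 * (sigma z * zeta z) ^ 3 - 8350 * sigma z ^ 3) * (sigma z ^ 3) ^ 2
      + 90 * (450441 * (sigma z * zeta z) ^ 3 - 23380 * sigma z ^ 3) * (sigma z ^ 3)
        * (sigma z * zeta z)
      - 378 * (3219 * (sigma z * zeta z) ^ 3 - 2680 * sigma z ^ 3) * (sigma z * zeta z) ^ 2
      + 147 * (2316 * (sigma z * zeta z) ^ 3 - 625 * sigma z ^ 3) * sigma z ^ 3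
      - 7875 * (3 * (sigma z * zeta z) ^ 3 - 14 * sigma z ^ 3) * (sigma z * zeta z)
      - 33075 * (sigma z * zeta z) ^ 2
      - 6720 * (12 * (sigma z * zeta z) ^ 3 - 125 * sigma z ^ 3)
      - 504000 * (sigma z * zeta z) - 5398750) := by
    simp only [upsilon3]; field_simp
  rw [e, zeta_cube hz, sigma_cube hz, sigma_mul_zeta hz, wRep, wFun]
  clear e
  simp only [polU3, bEval_cons, bEval_nil, lEval_cons, lEval_nil, uFun, vFun]
  generalize zeta z = w
  generalize qFun z = q at *
  obtain ⟨y, hy⟩ : ∃ y, y = z ^ 2 - 1 := ⟨_, rfl⟩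
  have hz2 : z ^ 2 = y + 1 := by rw [hy]; ring
  have hz6 : z ^ 6 = (y + 1) ^ 3 := by rw [← hz2]; ring
  have hy0 : 0 < y := by rw [hy]; exact h0
  simp only [hz6, hz2, add_sub_cancel_right]
  push_cast
  field_simp
  ring

lemma zHat1_eq {z : ℝ} (hz : 1 < z) :
    zHat1 z = bEval polZ1 (uFun z) (vFun z) / (24 * z) := by
  have h0 := sq_sub_one_pos hz
  have hq := qFun_pos hz
  have hz0 : 0 < z := by linarith
  have hne := zeta_ne_zero hz
  have e : zHat1 z = z * (sigma z * zeta z) / (48 * zeta z ^ 3) *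
      (10 * sigma z ^ 3 - 6 * (sigma z * zeta z) - 5) := by
    simp only [zHat1]; field_simp
  rw [e, zeta_cube hz, sigma_cube hz, sigma_mul_zeta hz]
  clear e
  simp only [polZ1, bEval_cons, bEval_nil, lEval_cons, lEval_nil, uFun, vFun]
  generalize qFun z = q at *
  obtain ⟨y, hy⟩ : ∃ y, y = z ^ 2 - 1 := ⟨_, rfl⟩
  have hz2 : z ^ 2 = y + 1 := by rw [hy]; ring
  have hy0 : 0 < y := by rw [hy]; exact h0
  push_cast
  simp only [hz2, add_sub_cancel_right]
  field_simp
  rw [hz2]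
  field_simp
  ring

lemma zHat2_eq {z : ℝ} (hz : 1 < z) :
    zHat2 z = -bEval polZ2 (uFun z) (vFun z) / (5760 * z ^ 3) := by
  have h0 := sq_sub_one_pos hz
  have hq := qFun_pos hz
  have hz0 : 0 < z := by linarith
  have hne := zeta_ne_zero hz
  have e : zHat2 z = z * (sigma z * zeta z) / (46080 * (zeta z ^ 3) ^ 2) *
      (200 * (sigma z ^ 3) ^ 3 * (35 * z ^ 2 + 221)
      - 80 * (sigma z ^ 3) ^ 2 * (sigma z * zeta z) * (75 * z ^ 2 + 982)
      - 4000 * (sigma z ^ 3) ^ 2 * z ^ 2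
      + 24 * sigma z ^ 3 * (sigma z * zeta z) ^ 2 * (45 * z ^ 2 + 1543)
      + 200 * sigma z ^ 3 * (sigma z * zeta z) * (6 * z ^ 2 - 5)
      + 600 * (sigma z * zeta z) ^ 2
      + 10 * (25 * z ^ 2 * sigma z ^ 3 - 264 * (sigma z * zeta z) ^ 3)
      + 250 * (sigma z * zeta z) - 5525) := by
    simp only [zHat2]; field_simp
  rw [e, zeta_cube hz, sigma_cube hz, sigma_mul_zeta hz]
  clear e
  simp only [polZ2, bEval_cons, bEval_nil, lEval_cons, lEval_nil, uFun, vFun]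
  generalize qFun z = q at *
  obtain ⟨y, hy⟩ : ∃ y, y = z ^ 2 - 1 := ⟨_, rfl⟩
  have hz2 : z ^ 2 = y + 1 := by rw [hy]; ring
  have hz3 : z ^ 3 = z * (y + 1) := by rw [← hz2]; ring
  have hy0 : 0 < y := by rw [hy]; exact h0
  simp only [hz3, hz2, add_sub_cancel_right]
  push_cast
  field_simp
  rw [hz2]
  ring

lemma zHat3_eq {z : ℝ} (hz : 1 < z) :
    zHat3 z = bEval polZ3 (uFun z) (vFun z) / (2903040 * z ^ 5) := by
  have h0 := sq_sub_one_pos hz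
  have hq := qFun_pos hz
  have hz0 : 0 < z := by linarith
  have hne := zeta_ne_zero hz
  have e : zHat3 z = z * (sigma z * zeta z) / (92897280 * (zeta z ^ 3) ^ 3) *
    (28000 * (sigma z ^ 3) ^ 5 * (650 * (z ^ 2) ^ 2 + 8619 * z ^ 2 + 89451)
      - 5600 * (sigma z ^ 3) ^ 4 * (sigma z * zeta z)
        * (3960 * (z ^ 2) ^ 2 + 86491 * z ^ 2 + 1338450)
      - 420000 * z ^ 2 * (sigma z ^ 3) ^ 4 * (35 * z ^ 2 + 221)
      + 1120 * (sigma z ^ 3) ^ 3 * (sigma z * zeta z) ^ 2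
        * (7290 * (z ^ 2) ^ 2 + 282717 * z ^ 2 + 7233983)
      + 8400 * (sigma z ^ 3) ^ 3 * (sigma z * zeta z) * (1200 * (z ^ 2) ^ 2 + 15187 * z ^ 2 - 1105)
      - 672 * (sigma z ^ 3) ^ 2 *
          (1260 * (z ^ 2) ^ 2 * (sigma z * zeta z) ^ 3 + 107859 * z ^ 2 * (sigma z * zeta z) ^ 3
            - 4375 * (z ^ 2) ^ 2 * sigma z ^ 3 + 5551275 * (sigma z * zeta z) ^ 3)
      - 3360 * (sigma z ^ 3) ^ 2 * (sigma z * zeta z) ^ 2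
        * (405 * (z ^ 2) ^ 2 + 12762 * z ^ 2 - 4910)
      + 24 * (sigma z ^ 3) * (sigma z * zeta z) *
          (136080 * z ^ 2 * (sigma z * zeta z) ^ 3 - 26250 * (z ^ 2) ^ 2 * sigma z ^ 3
            + 26578824 * (sigma z * zeta z) ^ 3 + 74375 * z ^ 2 * sigma z ^ 3)
      + 560 * sigma z ^ 3 * (2745 * z ^ 2 * (sigma z * zeta z) ^ 3
        - 125 * (z ^ 2) ^ 2 * sigma z ^ 3 - 13887 * (sigma z * zeta z) ^ 3
        - 16575 * z ^ 2 * sigma z ^ 3)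
      - 168 * (sigma z * zeta z) ^ 2 * (111564 * (sigma z * zeta z) ^ 3
        + 3375 * z ^ 2 * sigma z ^ 3 - 625 * sigma z ^ 3)
      + 700 * (sigma z * zeta z) * (792 * (sigma z * zeta z) ^ 3 + 3853 * z ^ 2 * sigma z ^ 3
        - 3315 * sigma z ^ 3)
      - 5250 * (12 * (sigma z * zeta z) ^ 3 - 221 * z ^ 2 * sigma z ^ 3)
      + 1374800 * (sigma z * zeta z) ^ 2 + 1160250 * (sigma z * zeta z) - 78269625) := by
    simp only [zHat3]; field_simp
  rw [e, zeta_cube hz, sigma_cube hz, sigma_mul_zeta hz]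
  clear e
  simp only [polZ3, bEval_cons, bEval_nil, lEval_cons, lEval_nil, uFun, vFun]
  generalize qFun z = q at *
  obtain ⟨y, hy⟩ : ∃ y, y = z ^ 2 - 1 := ⟨_, rfl⟩
  have hz2 : z ^ 2 = y + 1 := by rw [hy]; ring
  have hz5 : z ^ 5 = z * (y + 1) ^ 2 := by rw [← hz2]; ring
  have hy0 : 0 < y := by rw [hy]; exact h0
  simp only [hz5, hz2, add_sub_cancel_right]
  push_cast
  field_simp
  rw [hz2]
  ring

/-! ### Taylor bounds -/

lemma hasDerivAt_taylor_sum (c : ℕ → ℝ) (n : ℕ) (a x : ℝ) :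
    HasDerivAt (fun x => ∑ k ∈ Finset.range (n + 1), c k * (x - a) ^ k / k.factorial)
      (∑ k ∈ Finset.range n, c (k + 1) * (x - a) ^ k / k.factorial) x := by
  have h : (fun x => ∑ k ∈ Finset.range (n + 1), c k * (x - a) ^ k / (k.factorial : ℝ)) =
      fun x => ∑ k ∈ Finset.range n, c (k + 1) * (x - a) ^ (k + 1) / ((k + 1).factorial : ℝ)
        + c 0 := by
    funext x; rw [Finset.sum_range_succ']; simp
  rw [h]
  refine HasDerivAt.add_const _ (HasDerivAt.fun_sum fun k _ => ?_)
  have h1 := ((((hasDerivAt_id x).sub_const a).pow (k + 1)).const_mul (c (k + 1))).div_const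
    ((k + 1).factorial : ℝ)
  refine h1.congr_deriv ?_
  rw [Nat.factorial_succ]
  have : (k.factorial : ℝ) ≠ 0 := by positivity
  push_cast
  simp only [id]
  field_simp

/-- A one-sided Taylor bound. -/
lemma le_taylor_sum {n : ℕ} {F : ℕ → ℝ → ℝ} {a C : ℝ}
    (hF : ∀ k < n, ∀ x, a ≤ x → HasDerivAt (F k) (F (k + 1) x) x)
    (hC : ∀ x, a ≤ x → F n x ≤ C) {x : ℝ} (hx : a ≤ x) :
    F 0 x ≤ ∑ k ∈ Finset.range n, F k a * (x - a) ^ k / k.factorial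
      + C * (x - a) ^ n / n.factorial := by
  induction n generalizing F x with
  | zero => simpa using hC x hx
  | succ n ih =>
    have ih' := fun {x : ℝ} (hx : a ≤ x) =>
      ih (F := fun k => F (k + 1)) (fun k hk x hx => hF (k + 1) (by omega) x hx) hC hx
    -- Taylor coefficients with the top one replaced by the bound `C`. The derivative of this
    -- polynomial is the bound for `F 1` given by induction, so polynomial minus `F 0` is increasing
    -- from its value 0 at `a`.
    let c : ℕ → ℝ := fun k => if k = n + 1 then C else F k a
    have hc : ∀ x, ∑ k ∈ Finset.range (n + 1 + 1), c k * (x - a) ^ k / (k.factorial : ℝ) =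
        ∑ k ∈ Finset.range (n + 1), F k a * (x - a) ^ k / (k.factorial : ℝ)
          + C * (x - a) ^ (n + 1) / ((n + 1).factorial : ℝ) := by
      intro x
      rw [Finset.sum_range_succ]
      congr 1
      · refine Finset.sum_congr rfl fun k hk => ?_
        have := Finset.mem_range.1 hk
        simp only [c]; rw [if_neg (by omega)]
      · simp [c]
    have hc' : ∀ x, ∑ k ∈ Finset.range (n + 1), c (k + 1) * (x - a) ^ k / (k.factorial : ℝ) =
        ∑ k ∈ Finset.range n, F (k + 1) a * (x - a) ^ k / (k.factorial : ℝ)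
          + C * (x - a) ^ n / (n.factorial : ℝ) := by
      intro x
      rw [Finset.sum_range_succ]
      congr 1
      · refine Finset.sum_congr rfl fun k hk => ?_
        have := Finset.mem_range.1 hk
        simp only [c]; rw [if_neg (by omega)]
      · simp [c]
    have hd : ∀ x, a ≤ x → HasDerivAt
        (fun x => (∑ k ∈ Finset.range (n + 1 + 1), c k * (x - a) ^ k / (k.factorial : ℝ)) - F 0 x)
        ((∑ k ∈ Finset.range (n + 1), c (k + 1) * (x - a) ^ k / (k.factorial : ℝ)) - F 1 x) x :=
      fun x hx => (hasDerivAt_taylor_sum c (n + 1) a x).sub (hF 0 (by omega) x hx)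
    have hm : MonotoneOn
        (fun x => (∑ k ∈ Finset.range (n + 1 + 1), c k * (x - a) ^ k / (k.factorial : ℝ)) - F 0 x)
        (Set.Ici a) := by
      refine monotoneOn_of_deriv_nonneg (convex_Ici a)
        (fun x hx => (hd x hx).continuousAt.continuousWithinAt) ?_ ?_
      · rw [interior_Ici]
        exact fun x hx => (hd x (Set.mem_Ioi.1 hx).le).differentiableAt.differentiableWithinAt
      · rw [interior_Ici]
        intro x hx
        rw [(hd x (Set.mem_Ioi.1 hx).le).deriv, hc']
        exact sub_nonneg.2 (ih' (Set.mem_Ioi.1 hx).le)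
    have h1 := hm (Set.mem_Ici.2 le_rfl) (Set.mem_Ici.2 hx) hx
    simp only [hc] at h1
    have h2 : ∑ k ∈ Finset.range (n + 1), F k a * (a - a) ^ k / (k.factorial : ℝ)
          + C * (a - a) ^ (n + 1) / ((n + 1).factorial : ℝ) = F 0 a := by
      rw [Finset.sum_range_succ']; simp
    rw [h2] at h1
    linarith

lemma taylor_sum_le {n : ℕ} {F : ℕ → ℝ → ℝ} {a C : ℝ}
    (hF : ∀ k < n, ∀ x, a ≤ x → HasDerivAt (F k) (F (k + 1) x) x)
    (hC : ∀ x, a ≤ x → C ≤ F n x) {x : ℝ} (hx : a ≤ x) :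
    ∑ k ∈ Finset.range n, F k a * (x - a) ^ k / k.factorial
      + C * (x - a) ^ n / n.factorial ≤ F 0 x := by
  have h := le_taylor_sum (n := n) (F := fun k x => -F k x) (a := a) (C := -C)
    (fun k hk x hx => (hF k hk x hx).neg) (fun x hx => neg_le_neg (hC x hx)) hx
  have e : ∑ k ∈ Finset.range n, -F k a * (x - a) ^ k / (k.factorial : ℝ) =
      -∑ k ∈ Finset.range n, F k a * (x - a) ^ k / (k.factorial : ℝ) := by
    rw [← Finset.sum_neg_distrib]
    exact Finset.sum_congr rfl fun k _ => by ring
  simp only [e] at h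
  have e2 : -C * (x - a) ^ n / (n.factorial : ℝ) = -(C * (x - a) ^ n / (n.factorial : ℝ)) := by
    ring
  rw [e2] at h
  linarith

/-! ### Remainder estimates for the truncated reversion -/

section Remainder

variable {e a b c d l W1 W2 W3 W4 A0 A1 A2 A3 B0 B1 B2 C0 C1 : ℝ}

lemma mul_lt_of_le_one {x p : ℝ} (he : 0 < e) (he1 : e ≤ 1) (hp : 0 < p) (hx : x < p) :
    e * x < p := by
  rcases le_or_gt x 0 with h | h
  · exact (mul_nonpos_of_nonneg_of_nonpos he.le h).trans_lt hp
  · exact (mul_le_of_le_one_left h.le he1).trans_lt hx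

/-- The terms of `d` alternate in sign and decrease in size. -/
lemma reversion_bounds (he : 0 < e) (he1 : e ≤ 1) (ha : 0 < a) (hb : 0 < b) (hc : 0 < c)
    (hl : 0 < l) (hba : b ≤ a / 10) (hcb : l * c ≤ b)
    (hd : d = e * a - e ^ 2 * b + l * e ^ 3 * c) :
    0 < d ∧ d ≤ e * a ∧ e * a - d ≤ e ^ 2 * b := by
  subst hd
  have h1 : e ^ 2 * b ≤ e * b := by
    have : e ^ 2 ≤ e := by nlinarith
    exact mul_le_mul_of_nonneg_right this hb.le
  have h2 : l * e ^ 3 * c ≤ e ^ 2 * b := by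
    have h3 : e ^ 3 ≤ e ^ 2 := pow_le_pow_of_le_one he.le he1 (by norm_num)
    calc l * e ^ 3 * c = e ^ 3 * (l * c) := by ring
      _ ≤ e ^ 2 * b := mul_le_mul h3 hcb (by positivity) (by positivity)
  have h4 : 0 < l * e ^ 3 * c := by positivity
  have h5 : e * b ≤ e * (a / 10) := mul_le_mul_of_nonneg_left hba he.le
  have h6 : 0 < e * a := by positivity
  refine ⟨by linarith, by linarith, by linarith⟩

/-- `Wₖ`, `Aₖ`, `Bₖ`, `Cₖ` stand for `zᵏ/w` times the `k`-th derivatives of `w, Υ₁, Υ₂, Υ₃`, and `a,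
-b, c` for `ẑⱼ/z`. The relations for `A0, B0, C0` cancel orders `e` and `e²` and leave `-(1 - l) W1
c e³`; `hcert` says that the bound for the remaining terms, of order `e⁴`, is smaller than this at
`e = 1`. -/
theorem reversion_lower (he : 0 < e) (he1 : e ≤ 1) (ha : 0 < a) (hb : 0 < b) (hc : 0 < c)
    (hl : 0 < l) (hl1 : l < 1) (hba : b ≤ a / 10) (hcb : l * c ≤ b)
    (hd : d = e * a - e ^ 2 * b + l * e ^ 3 * c)
    (hW1 : 0 < W1) (hW2 : W2 ≤ 0) (hW3 : 0 ≤ W3) (hA2 : 0 ≤ A2) (hA3 : A3 ≤ 0) (hB1 : 0 ≤ B1)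
    (hB2 : B2 ≤ 0) (hC1 : C1 ≤ 0) (hA0 : A0 = W1 * a)
    (hB0 : B0 = -W1 * b + W2 * a ^ 2 / 2 - A1 * a)
    (hC0 : C0 = W1 * c - W2 * a * b + W3 * a ^ 3 / 6 + A1 * b - A2 * a ^ 2 / 2 - B1 * a)
    (hcert : l * c * (-A1 + 9 / 10 * W2 * a) + A2 * a * b + B1 * b - A3 * a ^ 3 / 6
      - B2 * a ^ 2 / 2 - C1 * a < (1 - l) * W1 * c) :
    W1 * d + W2 * d ^ 2 / 2 + W3 * d ^ 3 / 6 - e * (A0 + A1 * d + A2 * d ^ 2 / 2 + A3 * d ^ 3 / 6)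
      - e ^ 2 * (B0 + B1 * d + B2 * d ^ 2 / 2) - e ^ 3 * (C0 + C1 * d) < 0 := by
  obtain ⟨hd0, hda, hdb⟩ := reversion_bounds he he1 ha hb hc hl hba hcb hd
  have e0 : W1 * d + W2 * d ^ 2 / 2 + W3 * d ^ 3 / 6
      - e * (A0 + A1 * d + A2 * d ^ 2 / 2 + A3 * d ^ 3 / 6)
      - e ^ 2 * (B0 + B1 * d + B2 * d ^ 2 / 2) - e ^ 3 * (C0 + C1 * d) =
      W1 * (d - e * a + e ^ 2 * b - e ^ 3 * c)
      + W2 / 2 * (d ^ 2 - e ^ 2 * a ^ 2 + 2 * e ^ 3 * a * b)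
      + W3 / 6 * (d ^ 3 - (e * a) ^ 3) - e * A1 * (d - e * a + e ^ 2 * b)
      + e * A2 / 2 * (e ^ 2 * a ^ 2 - d ^ 2) + e ^ 2 * B1 * (e * a - d) - e * A3 * d ^ 3 / 6
      - e ^ 2 * B2 * d ^ 2 / 2 - e ^ 3 * C1 * d := by
    rw [hA0, hB0, hC0]; ring
  have e1 : d - e * a + e ^ 2 * b = l * e ^ 3 * c := by rw [hd]; ring
  -- The loss of one tenth absorbs the cross term `2 l e⁵ b c`, by `e b ≤ a/10`.
  have h1 : e ^ 4 * (2 * l * a * c) * (9 / 10) ≤ d ^ 2 - e ^ 2 * a ^ 2 + 2 * e ^ 3 * a * b := by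
    have e2 : d ^ 2 - e ^ 2 * a ^ 2 + 2 * e ^ 3 * a * b = e ^ 4 * (2 * l * a * c) * (9 / 10) +
        (e ^ 4 * (2 * l * c) * (a / 10 - e * b) + e ^ 4 * b ^ 2 + l ^ 2 * e ^ 6 * c ^ 2) := by
      rw [hd]; ring
    have h3 : e * b ≤ 1 * b := mul_le_mul_of_nonneg_right he1 hb.le
    have h4 : 0 ≤ e ^ 4 * (2 * l * c) * (a / 10 - e * b) :=
      mul_nonneg (by positivity) (by linarith)
    have h5 : 0 ≤ e ^ 4 * b ^ 2 := by positivity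
    have h6 : 0 ≤ l ^ 2 * e ^ 6 * c ^ 2 := by positivity
    linarith
  have h1' := mul_le_mul_of_nonpos_left h1 (by linarith : W2 / 2 ≤ 0)
  have hd3 : d ^ 3 ≤ (e * a) ^ 3 := pow_le_pow_left₀ hd0.le hda 3
  have hd2 : d ^ 2 ≤ (e * a) ^ 2 := pow_le_pow_left₀ hd0.le hda 2
  have h2 : W3 / 6 * (d ^ 3 - (e * a) ^ 3) ≤ 0 :=
    mul_nonpos_of_nonneg_of_nonpos (by linarith) (by linarith)
  have h4 : e ^ 2 * a ^ 2 - d ^ 2 ≤ e ^ 2 * b * (2 * (e * a)) := by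
    have e3 : e ^ 2 * a ^ 2 - d ^ 2 = (e * a - d) * (e * a + d) := by ring
    rw [e3]
    exact mul_le_mul hdb (by linarith) (by positivity) (by positivity)
  have h4' := mul_le_mul_of_nonneg_left h4 (by positivity : 0 ≤ e * A2 / 2)
  have h5 := mul_le_mul_of_nonneg_left hdb (by positivity : 0 ≤ e ^ 2 * B1)
  have h6 := mul_le_mul_of_nonneg_left hd3 (mul_nonneg he.le (neg_nonneg.2 hA3))
  have h7 := mul_le_mul_of_nonneg_left hd2 (by
    have : 0 ≤ -B2 := by linarith
    positivity : 0 ≤ e ^ 2 * (-B2))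
  have h8 := mul_le_mul_of_nonneg_left hda (by
    have : 0 ≤ -C1 := by linarith
    positivity : 0 ≤ e ^ 3 * (-C1))
  set X := l * c * (-A1 + 9 / 10 * W2 * a) + A2 * a * b + B1 * b - A3 * a ^ 3 / 6
      - B2 * a ^ 2 / 2 - C1 * a with hX
  -- `X` may be negative, so `e ≤ 1` alone does not give `e * X ≤ X`; positivity of the right side
  -- is used as well.
  have h9 : e * X < (1 - l) * W1 * c := by
    have hp : 0 < (1 - l) * W1 * c := by
      have : 0 < 1 - l := by linarith
      positivity
    exact mul_lt_of_le_one he he1 hp hcert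
  have h10 := mul_lt_mul_of_pos_left h9 (by positivity : 0 < e ^ 3)
  rw [e0, e1]
  have e5 : e ^ 3 * (e * X) = e ^ 4 * l * c * (-A1) + 9 / 10 * e ^ 4 * l * c * W2 * a
      + e ^ 4 * A2 * a * b + e ^ 4 * B1 * b - e ^ 4 * A3 * a ^ 3 / 6 - e ^ 4 * B2 * a ^ 2 / 2
      - e ^ 4 * C1 * a := by rw [hX]; ring
  rw [e5] at h10
  linear_combination h10 + h1' + h2 + h4' + h5 + h6 / 6 + h7 / 2 + h8

/-- Mirror image with `l > 1`. Here the terms containing `A1`, `A2` and `B1` have the favourable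
sign and are dropped, so only derivatives of `w` enter `hcert`. -/
theorem reversion_upper (he : 0 < e) (he1 : e ≤ 1) (ha : 0 < a) (hb : 0 < b) (hc : 0 < c)
    (hl1 : 1 < l) (hba : b ≤ a / 10) (hcb : l * c ≤ b)
    (hd : d = e * a - e ^ 2 * b + l * e ^ 3 * c)
    (hW1 : 0 < W1) (hW2 : W2 ≤ 0) (hW3 : 0 ≤ W3) (hW4 : W4 ≤ 0) (hA1 : A1 ≤ 0) (hA2 : 0 ≤ A2)
    (hB1 : 0 ≤ B1) (hA0 : A0 = W1 * a)
    (hB0 : B0 = -W1 * b + W2 * a ^ 2 / 2 - A1 * a)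
    (hC0 : C0 = W1 * c - W2 * a * b + W3 * a ^ 3 / 6 + A1 * b - A2 * a ^ 2 / 2 - B1 * a)
    (hcert : -W2 * (b ^ 2 / 2 + l * a * c) + W3 * a ^ 2 * b / 2 - W4 * a ^ 4 / 24 <
      (l - 1) * W1 * c) :
    0 < W1 * d + W2 * d ^ 2 / 2 + W3 * d ^ 3 / 6 + W4 * d ^ 4 / 24
      - e * (A0 + A1 * d + A2 * d ^ 2 / 2) - e ^ 2 * (B0 + B1 * d) - e ^ 3 * C0 := by
  have hl : 0 < l := by linarith
  obtain ⟨hd0, hda, hdb⟩ := reversion_bounds he he1 ha hb hc hl hba hcb hd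
  have e0 : W1 * d + W2 * d ^ 2 / 2 + W3 * d ^ 3 / 6 + W4 * d ^ 4 / 24
      - e * (A0 + A1 * d + A2 * d ^ 2 / 2) - e ^ 2 * (B0 + B1 * d) - e ^ 3 * C0 =
      W1 * (d - e * a + e ^ 2 * b - e ^ 3 * c)
      + W2 / 2 * (d ^ 2 - e ^ 2 * a ^ 2 + 2 * e ^ 3 * a * b)
      - W3 / 6 * ((e * a) ^ 3 - d ^ 3) + W4 * d ^ 4 / 24 - e * A1 * (d - e * a + e ^ 2 * b)
      + e * A2 / 2 * ((e * a) ^ 2 - d ^ 2) + e ^ 2 * B1 * (e * a - d) := by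
    rw [hA0, hB0, hC0]; ring
  have e1 : d - e * a + e ^ 2 * b = l * e ^ 3 * c := by rw [hd]; ring
  have h1 : d ^ 2 - e ^ 2 * a ^ 2 + 2 * e ^ 3 * a * b ≤ e ^ 4 * (b ^ 2 + 2 * l * a * c) := by
    have e2 : d ^ 2 - e ^ 2 * a ^ 2 + 2 * e ^ 3 * a * b = e ^ 4 * (b ^ 2 + 2 * l * a * c) -
        l * e ^ 5 * c * (2 * b - e * (l * c)) := by
      rw [hd]; ring
    have h3 : e * (l * c) ≤ 1 * b := mul_le_mul he1 hcb (by positivity) (by norm_num)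
    have h4 : 0 ≤ l * e ^ 5 * c * (2 * b - e * (l * c)) :=
      mul_nonneg (by positivity) (by linarith)
    linarith
  have h1' := mul_le_mul_of_nonpos_left h1 (by linarith : W2 / 2 ≤ 0)
  have h2 : (e * a) ^ 3 - d ^ 3 ≤ e ^ 2 * b * (3 * (e * a) ^ 2) := by
    have e3 : (e * a) ^ 3 - d ^ 3 = (e * a - d) * ((e * a) ^ 2 + e * a * d + d ^ 2) := by ring
    rw [e3]
    refine mul_le_mul hdb ?_ (by positivity) (by positivity)
    nlinarith
  have h2' := mul_le_mul_of_nonneg_left h2 (by positivity : 0 ≤ W3 / 6)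
  have hd4 : d ^ 4 ≤ (e * a) ^ 4 := pow_le_pow_left₀ hd0.le hda 4
  have hd2 : d ^ 2 ≤ (e * a) ^ 2 := pow_le_pow_left₀ hd0.le hda 2
  have h3 := mul_le_mul_of_nonneg_left hd4 (by linarith : 0 ≤ -W4)
  have h4 : 0 ≤ e * (-A1) * (l * e ^ 3 * c) := by
    have : 0 ≤ -A1 := by linarith
    positivity
  have h5 : 0 ≤ e * A2 / 2 * ((e * a) ^ 2 - d ^ 2) := mul_nonneg (by positivity) (by linarith)
  have h6 : 0 ≤ e ^ 2 * B1 * (e * a - d) := mul_nonneg (by positivity) (by linarith)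
  set X := -W2 * (b ^ 2 / 2 + l * a * c) + W3 * a ^ 2 * b / 2 - W4 * a ^ 4 / 24 with hX
  have h9 : e * X < (l - 1) * W1 * c := by
    have hp : 0 < (l - 1) * W1 * c := by
      have : 0 < l - 1 := by linarith
      positivity
    exact mul_lt_of_le_one he he1 hp hcert
  have h10 := mul_lt_mul_of_pos_left h9 (by positivity : 0 < e ^ 3)
  rw [e0, e1]
  have e5 : e ^ 3 * (e * X) = -(e ^ 4 * W2 * b ^ 2 / 2) - e ^ 4 * W2 * l * a * c
      + e ^ 4 * W3 * a ^ 2 * b / 2 - e ^ 4 * W4 * a ^ 4 / 24 := by rw [hX]; ring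
  rw [e5] at h10
  linear_combination h10 + h1' + h2' + h3 / 24 + h4 + h5 + h6

end Remainder

/-! ### The implicit equation near the leading approximation -/

/-- With the increment `z d` the powers `zᵏ` cancel, leaving a polynomial in the relative shift `d`
alone. -/
lemma wRep_taylor_term (n k : ℕ) (B : List (List ℤ)) {z : ℝ} (hz : 1 < z) (d : ℝ) :
    wRep (n + k) (bSteps n k B) z * (z * (1 + d) - z) ^ k =
      wFun z * (bEval (bSteps n k B) (uFun z) (vFun z) / z ^ n) * d ^ k := by
  have hz0 : z ≠ 0 := by linarith
  rw [wRep, show z * (1 + d) - z = z * d by ring, mul_pow, pow_add]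
  field_simp

/-- The Taylor polynomial of `wRep n B` at `z` and `z (1 + d)`, divided by `w z`. -/
noncomputable def wTaylor (n m : ℕ) (B : List (List ℤ)) (z d : ℝ) : ℝ :=
  ∑ k ∈ Finset.range m, bEval (bSteps n k B) (uFun z) (vFun z) / z ^ n * d ^ k / k.factorial

lemma wRep_taylor_sum (n m : ℕ) (B : List (List ℤ)) {z : ℝ} (hz : 1 < z) (d : ℝ) :
    ∑ k ∈ Finset.range m, wRep (n + k) (bSteps n k B) z * (z * (1 + d) - z) ^ k / k.factorial =
      wFun z * wTaylor n m B z d := by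
  rw [wTaylor, Finset.mul_sum]
  refine Finset.sum_congr rfl fun k _ => ?_
  rw [wRep_taylor_term n k B hz]; ring

/-- An omitted derivative of constant sign allows the remainder bound `C = 0`. -/
lemma wRep_le_of_nonpos {n m : ℕ} {B : List (List ℤ)}
    (h : ∀ x, 1 < x → wRep (n + m) (bSteps n m B) x ≤ 0) {z d : ℝ} (hz : 1 < z) (hd : 0 ≤ d) :
    wRep n B (z * (1 + d)) ≤ wFun z * wTaylor n m B z d := by
  have h1 := le_taylor_sum (n := m) (F := fun k => wRep (n + k) (bSteps n k B)) (a := z) (C := 0)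
    (fun k _ x hx => hasDerivAt_wRep_bSteps n k B (hz.trans_le hx))
    (fun x hx => h x (hz.trans_le hx)) (x := z * (1 + d)) (by nlinarith)
  simp only [wRep_taylor_sum n m B hz d, zero_mul, zero_div, add_zero] at h1
  exact h1

lemma le_wRep_of_nonneg {n m : ℕ} {B : List (List ℤ)}
    (h : ∀ x, 1 < x → 0 ≤ wRep (n + m) (bSteps n m B) x) {z d : ℝ} (hz : 1 < z) (hd : 0 ≤ d) :
    wFun z * wTaylor n m B z d ≤ wRep n B (z * (1 + d)) := by
  have h1 := taylor_sum_le (n := m) (F := fun k => wRep (n + k) (bSteps n k B)) (a := z) (C := 0)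
    (fun k _ x hx => hasDerivAt_wRep_bSteps n k B (hz.trans_le hx))
    (fun x hx => h x (hz.trans_le hx)) (x := z * (1 + d)) (by nlinarith)
  simp only [wRep_taylor_sum n m B hz d, zero_mul, zero_div, add_zero] at h1
  exact h1

/-- The function `w - e Υ₁ - e² Υ₂ - e³ Υ₃`, which is `-𝒵₃` for `e = 1 / ν²`. -/
noncomputable def kFun (e z : ℝ) : ℝ :=
  wRep 0 bOne z - e * (wRep 2 polU1 z / 12) - e ^ 2 * (wRep 4 polU2 z / 2880)
    - e ^ 3 * (wRep 6 polU3 z / 1451520)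

lemma wRep_bOne (z : ℝ) : wRep 0 bOne z = wFun z := by simp [wRep, bOne]

lemma scriptZ3_eq (ν : ℝ) {z : ℝ} (hz : 1 < z) : scriptZ3 ν z = -kFun (1 / ν ^ 2) z := by
  rw [scriptZ3, kFun, upsilon1_eq hz, upsilon2_eq hz, upsilon3_eq hz, wRep_bOne, wFun]
  ring

/-- Multiplication of a certificate by `U` and `U - 1` accounts for powers of `z⁻²`. -/
lemma lt_of_uFun_certificate {z p r : ℝ} (hz : 1 < z) (h : 0 < uFun z * p + (1 - uFun z) * r) :
    r * (z ^ 2)⁻¹ < p := by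
  have hu := uFun_pos hz
  have h1 : uFun z * p + (1 - uFun z) * r = uFun z * (p - r * (z ^ 2)⁻¹) := by
    have := one_sub_inv_uFun hz
    rw [show 1 - uFun z = -(uFun z / z ^ 2) by rw [← this]; ring]
    ring
  rw [h1] at h
  linarith [pos_of_mul_pos_right h hu.le]

/-! ### The certificates as inequalities and identities at `z` -/

lemma bEval_neg_of_posCheck {B : List (List ℤ)} (h : posCheck (bSmul (-1) B) = true) {z : ℝ}
    (hz : 1 < z) : bEval B (uFun z) (vFun z) < 0 := by
  have h1 := bEval_pos_of_posCheck h hz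
  rw [bEval_bSmul] at h1
  push_cast at h1
  linarith

/-- The value of `B(U, V)` at `z`. -/
noncomputable def uvEval (B : List (List ℤ)) (z : ℝ) : ℝ := bEval B (uFun z) (vFun z)

/-- This is `b < a/10` for `a = ẑ₁/z` and `b = -ẑ₂/z`; `24 = 5760/240`. -/
lemma polZ2_le_polZ1 {z : ℝ} (hz : 1 < z) :
    uvEval polZ2 z * (z ^ 2)⁻¹ < 24 * uvEval polZ1 z := by
  have h := bEval_pos_of_posCheck posCheck_polZ1_sub_polZ2 hz
  simp only [bEval_bAdd, bEval_bSmul, bEval_bMul, bEval_cons, lEval_cons, lEval_nil, bEval_nil] at h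
  refine lt_of_uFun_certificate hz ?_
  unfold uvEval
  push_cast at h
  linarith

/-- This is `l c < b` for the larger value `l = 1.013023`, with `504 = 2903040/5760`. -/
lemma polZ3_le_polZ2 {z : ℝ} (hz : 1 < z) :
    1013023 * uvEval polZ3 z * (z ^ 2)⁻¹ < 504000000 * uvEval polZ2 z := by
  have h := bEval_pos_of_posCheck posCheck_polZ2_sub_polZ3 hz
  simp only [bEval_bAdd, bEval_bSmul, bEval_bMul, bEval_cons, lEval_cons, lEval_nil, bEval_nil] at h
  refine lt_of_uFun_certificate hz ?_
  unfold uvEval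
  push_cast at h
  linarith

lemma derU2_le_derW {z : ℝ} (hz : 1 < z) :
    uvEval (derU2 1) z * (z ^ 2)⁻¹ ^ 2 < 2880 * uvEval (derW 1) z := by
  have h := bEval_pos_of_posCheck posCheck_derW_sub_derU2 hz
  have hu := uFun_pos hz
  simp only [bEval_bAdd, bEval_bSmul, bEval_bMul, bEval_cons, lEval_cons, lEval_nil, bEval_nil] at h
  have h1 := one_sub_inv_uFun hz
  have h2 : 0 < uFun z ^ 2 *
      (2880 * uvEval (derW 1) z - uvEval (derU2 1) z * (z ^ 2)⁻¹ ^ 2) := by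
    have e : uFun z ^ 2 * (2880 * uvEval (derW 1) z - uvEval (derU2 1) z * (z ^ 2)⁻¹ ^ 2) =
        2880 * uFun z ^ 2 * uvEval (derW 1) z - (uFun z / z ^ 2) ^ 2 * uvEval (derU2 1) z := by
      rw [div_eq_mul_inv]; ring
    rw [e, ← h1]
    unfold uvEval
    push_cast at h
    linarith
  linarith [pos_of_mul_pos_right h2 (by positivity)]

/-- The hypothesis `hcert` of `reversion_lower` with denominators cleared. For `l = 0.969746` the
constants containing `l` are `9697460 = 10⁷ l`, `4363857 = 5·10⁶ (9/10) l` and `3630480 = 1.2·10⁸ (1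
- l)`. -/
lemma polLower_certificate {z : ℝ} (hz : 1 < z) :
    (-9697460 * (uvEval polZ3 z * uvEval (derU1 1) z)
      + 4363857 * (uvEval polZ3 z * uvEval (derW 2) z * uvEval polZ1 z)
      + 210000000 * (uvEval (derU1 2) z * uvEval polZ1 z * uvEval polZ2 z)
      + 21000000 * (uvEval (derU2 1) z * uvEval polZ2 z)
      - 350000000 * (uvEval (derU1 3) z * uvEval polZ1 z ^ 3)
      - 105000000 * (uvEval (derU2 2) z * uvEval polZ1 z ^ 2)
      - 10000000 * (uvEval (derU3 1) z * uvEval polZ1 z)) * (z ^ 2)⁻¹ <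
    3630480 * (uvEval (derW 1) z * uvEval polZ3 z) := by
  have h := bEval_pos_of_posCheck posCheck_polLower hz
  simp only [polLower, bSum, bEval_bAdd, bEval_bSmul, bEval_bMul, bEval_cons, lEval_cons,
    lEval_nil, bEval_nil] at h
  refine lt_of_uFun_certificate hz ?_
  unfold uvEval
  push_cast at h
  linear_combination h

/-- The same for `reversion_upper` with `l = 1.013023`: `20260460 = 2·10⁷ l` and `6251040 = 4.8·10⁸
(l - 1)`. -/
lemma polUpper_certificate {z : ℝ} (hz : 1 < z) :
    (-21000000 * (uvEval (derW 2) z * uvEval polZ2 z ^ 2)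
      - 20260460 * (uvEval (derW 2) z * uvEval polZ1 z * uvEval polZ3 z)
      + 210000000 * (uvEval (derW 3) z * uvEval polZ1 z ^ 2 * uvEval polZ2 z)
      - 175000000 * (uvEval (derW 4) z * uvEval polZ1 z ^ 4)) * (z ^ 2)⁻¹ <
    6251040 * (uvEval (derW 1) z * uvEval polZ3 z) := by
  have h := bEval_pos_of_posCheck posCheck_polUpper hz
  simp only [polUpper, bSum, bEval_bAdd, bEval_bSmul, bEval_bMul, bEval_cons, lEval_cons,
    lEval_nil, bEval_nil] at h
  refine lt_of_uFun_certificate hz ?_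
  unfold uvEval
  push_cast at h
  linear_combination h

lemma first_order {z : ℝ} : uvEval (derW 1) z * uvEval polZ1 z - 2 * uvEval polU1 z = 0 := by
  have h := bEval_eq_zero bZero_first_order (uFun z) (vFun z)
  simp only [bEval_bAdd, bEval_bSmul, bEval_bMul] at h
  unfold uvEval
  push_cast at h
  linear_combination h

lemma second_order {z : ℝ} : -2 * (uvEval (derW 1) z * uvEval polZ2 z)
    + 10 * (uvEval (derW 2) z * uvEval polZ1 z ^ 2) - 40 * (uvEval (derU1 1) z * uvEval polZ1 z)
    - 4 * uvEval polU2 z = 0 := by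
  have h := bEval_eq_zero bZero_second_order (uFun z) (vFun z)
  simp only [bSum, bEval_bAdd, bEval_bSmul, bEval_bMul, bEval_nil] at h
  unfold uvEval
  push_cast at h
  linear_combination h

lemma third_order {z : ℝ} : 120 * (uvEval (derW 1) z * uvEval polZ3 z)
    - 2520 * (uvEval (derW 2) z * uvEval polZ1 z * uvEval polZ2 z)
    + 4200 * (uvEval (derW 3) z * uvEval polZ1 z ^ 3)
    + 5040 * (uvEval (derU1 1) z * uvEval polZ2 z)
    - 25200 * (uvEval (derU1 2) z * uvEval polZ1 z ^ 2)
    - 5040 * (uvEval (derU2 1) z * uvEval polZ1 z) - 240 * uvEval polU3 z = 0 := by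
  have h := bEval_eq_zero bZero_third_order (uFun z) (vFun z)
  simp only [bSum, bEval_bAdd, bEval_bSmul, bEval_bMul, bEval_nil] at h
  unfold uvEval
  push_cast at h
  linear_combination h

lemma derW_one_pos {z : ℝ} (hz : 1 < z) : 0 < uvEval (derW 1) z := by
  have : uvEval (derW 1) z = 2 * vFun z := by
    simp [uvEval, derW, bSteps, bStep, bStepAux, bOne, stepRow, bAdd, lAdd, lSmul]
    ring
  rw [this]
  have := vFun_pos hz
  positivity

/-- The relative shift `(e ẑ₁ + e² ẑ₂ + l e³ ẑ₃) / z`. -/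
noncomputable def relShift (e l z : ℝ) : ℝ :=
  e * (uvEval polZ1 z * (z ^ 2)⁻¹ / 24) - e ^ 2 * (uvEval polZ2 z * (z ^ 2)⁻¹ ^ 2 / 5760)
    + l * e ^ 3 * (uvEval polZ3 z * (z ^ 2)⁻¹ ^ 3 / 2903040)

lemma mul_one_add_relShift (e l : ℝ) {z : ℝ} (hz : 1 < z) :
    z * (1 + relShift e l z) = z + zHat1 z * e + zHat2 z * e ^ 2 + l * zHat3 z * e ^ 3 := by
  have hz0 : z ≠ 0 := by linarith
  rw [relShift, zHat1_eq hz, zHat2_eq hz, zHat3_eq hz]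
  unfold uvEval
  field_simp
  ring

lemma wTaylor_bOne (m : ℕ) (z d : ℝ) : wTaylor 0 m bOne z d =
    ∑ k ∈ Finset.range m, uvEval (derW k) z * d ^ k / k.factorial := by
  refine Finset.sum_congr rfl fun k _ => ?_
  rw [pow_zero, div_one]; rfl

lemma wTaylor_polU1 (m : ℕ) (z d : ℝ) : wTaylor 2 m polU1 z d =
    ∑ k ∈ Finset.range m, uvEval (derU1 k) z * (z ^ 2)⁻¹ * d ^ k / k.factorial :=
  Finset.sum_congr rfl fun _ _ => rfl

lemma wTaylor_polU2 (m : ℕ) (z d : ℝ) : wTaylor 4 m polU2 z d =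
    ∑ k ∈ Finset.range m, uvEval (derU2 k) z * (z ^ 2)⁻¹ ^ 2 * d ^ k / k.factorial := by
  refine Finset.sum_congr rfl fun k _ => ?_
  rw [← inv_pow, ← pow_mul, inv_pow, ← div_eq_mul_inv]; rfl

lemma wTaylor_polU3 (m : ℕ) (z d : ℝ) : wTaylor 6 m polU3 z d =
    ∑ k ∈ Finset.range m, uvEval (derU3 k) z * (z ^ 2)⁻¹ ^ 3 * d ^ k / k.factorial := by
  refine Finset.sum_congr rfl fun k _ => ?_
  rw [← inv_pow, ← pow_mul, inv_pow, ← div_eq_mul_inv]; rfl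

lemma uvEval_derW_zero (z : ℝ) : uvEval (derW 0) z = 1 := by
  simp [uvEval, derW, bSteps, bOne]

lemma shift_coefficients {z : ℝ} (hz : 1 < z) :
    0 < uvEval polZ1 z * (z ^ 2)⁻¹ / 24 ∧ 0 < uvEval polZ2 z * (z ^ 2)⁻¹ ^ 2 / 5760 ∧
    0 < uvEval polZ3 z * (z ^ 2)⁻¹ ^ 3 / 2903040 ∧
    uvEval polZ2 z * (z ^ 2)⁻¹ ^ 2 / 5760 ≤ uvEval polZ1 z * (z ^ 2)⁻¹ / 24 / 10 ∧
    ∀ l : ℝ, l ≤ 1.013023 → l * (uvEval polZ3 z * (z ^ 2)⁻¹ ^ 3 / 2903040) ≤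
      uvEval polZ2 z * (z ^ 2)⁻¹ ^ 2 / 5760 := by
  have h1 : 0 < uvEval polZ1 z := bEval_pos_of_posCheck posCheck_polZ1 hz
  have h2 : 0 < uvEval polZ2 z := bEval_pos_of_posCheck posCheck_polZ2 hz
  have h3 : 0 < uvEval polZ3 z := bEval_pos_of_posCheck posCheck_polZ3 hz
  have hz0 : 0 < z := by linarith
  have hk : 0 < (z ^ 2)⁻¹ := by positivity
  have h4 := polZ2_le_polZ1 hz
  have h5 := polZ3_le_polZ2 hz
  generalize (z ^ 2)⁻¹ = k at *
  refine ⟨by positivity, by positivity, by positivity, ?_, fun l hl => ?_⟩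
  · have := mul_le_mul_of_nonneg_left h4.le hk.le
    linarith
  · have h6 : l * (uvEval polZ3 z * k ^ 3 / 2903040) ≤
        1.013023 * (uvEval polZ3 z * k ^ 3 / 2903040) :=
      mul_le_mul_of_nonneg_right hl (by positivity)
    have h7 := mul_le_mul_of_nonneg_left h5.le (by positivity : 0 ≤ k ^ 2)
    linarith

/-- Each Taylor polynomial stops where the next derivative has the sign that bounds `K` from above:
`w⁗ < 0`, while `Υ₁⁗`, `Υ₂'''` and `Υ₃''` are positive. -/
theorem kFun_lower_lt {e z : ℝ} (he : 0 < e) (he1 : e ≤ 1) (hz : 1 < z) :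
    kFun e (z * (1 + relShift e 0.969746 z)) < wFun z := by
  have hz0 : 0 < z := by linarith
  have hw := wFun_pos hz
  obtain ⟨ha, hb, hc, hba, hcb⟩ := shift_coefficients hz
  have hcb := hcb 0.969746 (by norm_num)
  have hd0 : 0 < relShift e 0.969746 z :=
    (reversion_bounds he he1 ha hb hc (by norm_num) hba hcb rfl).1
  have t0 := wRep_le_of_nonpos (n := 0) (m := 4) (B := bOne)
    (fun x hx => (wRep_neg _ posCheck_neg_derW_four hx).le) hz hd0.le
  have t1 := le_wRep_of_nonneg (n := 2) (m := 4) (B := polU1)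
    (fun x hx => (wRep_pos _ posCheck_derU1_four hx).le) hz hd0.le
  have t2 := le_wRep_of_nonneg (n := 4) (m := 3) (B := polU2)
    (fun x hx => (wRep_pos _ posCheck_derU2_three hx).le) hz hd0.le
  have t3 := le_wRep_of_nonneg (n := 6) (m := 2) (B := polU3)
    (fun x hx => (wRep_pos _ posCheck_derU3_two hx).le) hz hd0.le
  have hk : 0 < (z ^ 2)⁻¹ := by positivity
  have main := reversion_lower (d := relShift e 0.969746 z) (W1 := uvEval (derW 1) z) (W2 := uvEval (derW 2) z)
    (W3 := uvEval (derW 3) z) (A0 := uvEval polU1 z * (z ^ 2)⁻¹ / 12)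
    (A1 := uvEval (derU1 1) z * (z ^ 2)⁻¹ / 12) (A2 := uvEval (derU1 2) z * (z ^ 2)⁻¹ / 12)
    (A3 := uvEval (derU1 3) z * (z ^ 2)⁻¹ / 12) (B0 := uvEval polU2 z * (z ^ 2)⁻¹ ^ 2 / 2880)
    (B1 := uvEval (derU2 1) z * (z ^ 2)⁻¹ ^ 2 / 2880)
    (B2 := uvEval (derU2 2) z * (z ^ 2)⁻¹ ^ 2 / 2880)
    (C0 := uvEval polU3 z * (z ^ 2)⁻¹ ^ 3 / 1451520)
    (C1 := uvEval (derU3 1) z * (z ^ 2)⁻¹ ^ 3 / 1451520)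
    he he1 ha hb hc (by norm_num) (by norm_num) hba hcb rfl (derW_one_pos hz)
    (bEval_neg_of_posCheck posCheck_neg_derW_two hz).le
    (bEval_pos_of_posCheck posCheck_derW_three hz).le
    (by have : 0 < uvEval (derU1 2) z := bEval_pos_of_posCheck posCheck_derU1_two hz
        positivity)
    (by have : uvEval (derU1 3) z < 0 := bEval_neg_of_posCheck posCheck_neg_derU1_three hz
        have := mul_neg_of_neg_of_pos this hk
        linarith)
    (by have : 0 < uvEval (derU2 1) z := bEval_pos_of_posCheck posCheck_derU2_one hz
        positivity)
    (by have : uvEval (derU2 2) z < 0 := bEval_neg_of_posCheck posCheck_neg_derU2_two hz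
        have := mul_neg_of_neg_of_pos this (pow_pos hk 2)
        linarith)
    (by have : uvEval (derU3 1) z < 0 := bEval_neg_of_posCheck posCheck_neg_derU3_one hz
        have := mul_neg_of_neg_of_pos this (pow_pos hk 3)
        linarith)
    -- The three reversion identities supply the relations for `A0`, `B0` and `C0`.
    (by linear_combination (-(z ^ 2)⁻¹ / 24) * first_order (z := z))
    (by linear_combination (-(z ^ 2)⁻¹ ^ 2 / 11520) * second_order (z := z))
    (by linear_combination (-(z ^ 2)⁻¹ ^ 3 / 348364800) * third_order (z := z))
    (by have := mul_lt_mul_of_pos_right (polLower_certificate hz)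
          (by positivity : 0 < (z ^ 2)⁻¹ ^ 3 / 348364800000000)
        linear_combination this)
  have main' := mul_neg_of_pos_of_neg hw main
  have t1' := mul_le_mul_of_nonneg_left t1 (by positivity : 0 ≤ e / 12)
  have t2' := mul_le_mul_of_nonneg_left t2 (by positivity : 0 ≤ e ^ 2 / 2880)
  have t3' := mul_le_mul_of_nonneg_left t3 (by positivity : 0 ≤ e ^ 3 / 1451520)
  rw [wTaylor_bOne] at t0
  rw [wTaylor_polU1] at t1'
  rw [wTaylor_polU2] at t2'
  rw [wTaylor_polU3] at t3'
  simp only [Finset.sum_range_succ, Finset.sum_range_zero, uvEval_derW_zero,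
    Nat.factorial] at t0 t1' t2' t3'
  rw [show uvEval (derU1 0) z = uvEval polU1 z from rfl] at t1'
  rw [show uvEval (derU2 0) z = uvEval polU2 z from rfl] at t2'
  rw [show uvEval (derU3 0) z = uvEval polU3 z from rfl] at t3'
  push_cast at t0 t1' t2' t3'
  rw [kFun]
  generalize relShift e 0.969746 z = d at *
  linear_combination main' + t0 + t1' + t2' + t3'

/-- The signs are now `w⁽⁵⁾ > 0` and `Υ₁''', Υ₂'', Υ₃' < 0`, which bound `K` from below. -/
theorem lt_kFun_upper {e z : ℝ} (he : 0 < e) (he1 : e ≤ 1) (hz : 1 < z) :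
    wFun z < kFun e (z * (1 + relShift e 1.013023 z)) := by
  have hz0 : 0 < z := by linarith
  have hw := wFun_pos hz
  obtain ⟨ha, hb, hc, hba, hcb⟩ := shift_coefficients hz
  have hcb := hcb 1.013023 (by norm_num)
  have hd0 : 0 < relShift e 1.013023 z :=
    (reversion_bounds he he1 ha hb hc (by norm_num) hba hcb rfl).1
  have t0 := le_wRep_of_nonneg (n := 0) (m := 5) (B := bOne)
    (fun x hx => (wRep_pos _ posCheck_derW_five hx).le) hz hd0.le
  have t1 := wRep_le_of_nonpos (n := 2) (m := 3) (B := polU1)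
    (fun x hx => (wRep_neg _ posCheck_neg_derU1_three hx).le) hz hd0.le
  have t2 := wRep_le_of_nonpos (n := 4) (m := 2) (B := polU2)
    (fun x hx => (wRep_neg _ posCheck_neg_derU2_two hx).le) hz hd0.le
  have t3 := wRep_le_of_nonpos (n := 6) (m := 1) (B := polU3)
    (fun x hx => (wRep_neg _ posCheck_neg_derU3_one hx).le) hz hd0.le
  have hk : 0 < (z ^ 2)⁻¹ := by positivity
  have main := reversion_upper (d := relShift e 1.013023 z) (W1 := uvEval (derW 1) z) (W2 := uvEval (derW 2) z)
    (W3 := uvEval (derW 3) z) (W4 := uvEval (derW 4) z)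
    (A0 := uvEval polU1 z * (z ^ 2)⁻¹ / 12)
    (A1 := uvEval (derU1 1) z * (z ^ 2)⁻¹ / 12) (A2 := uvEval (derU1 2) z * (z ^ 2)⁻¹ / 12)
    (B0 := uvEval polU2 z * (z ^ 2)⁻¹ ^ 2 / 2880)
    (B1 := uvEval (derU2 1) z * (z ^ 2)⁻¹ ^ 2 / 2880)
    (C0 := uvEval polU3 z * (z ^ 2)⁻¹ ^ 3 / 1451520)
    he he1 ha hb hc (by norm_num) hba hcb rfl (derW_one_pos hz)
    (bEval_neg_of_posCheck posCheck_neg_derW_two hz).le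
    (bEval_pos_of_posCheck posCheck_derW_three hz).le
    (bEval_neg_of_posCheck posCheck_neg_derW_four hz).le
    (by have : uvEval (derU1 1) z < 0 := bEval_neg_of_posCheck posCheck_neg_derU1_one hz
        have := mul_neg_of_neg_of_pos this hk
        linarith)
    (by have : 0 < uvEval (derU1 2) z := bEval_pos_of_posCheck posCheck_derU1_two hz
        positivity)
    (by have : 0 < uvEval (derU2 1) z := bEval_pos_of_posCheck posCheck_derU2_one hz
        positivity)
    (by linear_combination (-(z ^ 2)⁻¹ / 24) * first_order (z := z))
    (by linear_combination (-(z ^ 2)⁻¹ ^ 2 / 11520) * second_order (z := z))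
    (by linear_combination (-(z ^ 2)⁻¹ ^ 3 / 348364800) * third_order (z := z))
    (by have := mul_lt_mul_of_pos_right (polUpper_certificate hz)
          (by positivity : 0 < (z ^ 2)⁻¹ ^ 3 / 1393459200000000)
        linear_combination this)
  have main' := mul_pos hw main
  have t1' := mul_le_mul_of_nonneg_left t1 (by positivity : 0 ≤ e / 12)
  have t2' := mul_le_mul_of_nonneg_left t2 (by positivity : 0 ≤ e ^ 2 / 2880)
  have t3' := mul_le_mul_of_nonneg_left t3 (by positivity : 0 ≤ e ^ 3 / 1451520)
  rw [wTaylor_bOne] at t0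
  rw [wTaylor_polU1] at t1'
  rw [wTaylor_polU2] at t2'
  rw [wTaylor_polU3] at t3'
  simp only [Finset.sum_range_succ, Finset.sum_range_zero, uvEval_derW_zero,
    Nat.factorial] at t0 t1' t2' t3'
  rw [show uvEval (derU1 0) z = uvEval polU1 z from rfl] at t1'
  rw [show uvEval (derU2 0) z = uvEval polU2 z from rfl] at t2'
  rw [show uvEval (derU3 0) z = uvEval polU3 z from rfl] at t3'
  push_cast at t0 t1' t2' t3'
  rw [kFun]
  generalize relShift e 1.013023 z = d at *
  linear_combination main' + t0 + t1' + t2' + t3'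

/-! ### Monotonicity of the implicit function -/

lemma hasDerivAt_kFun (e : ℝ) {z : ℝ} (hz : 1 < z) : HasDerivAt (kFun e)
    (wRep 1 (derW 1) z - e * (wRep 3 (derU1 1) z / 12) - e ^ 2 * (wRep 5 (derU2 1) z / 2880)
      - e ^ 3 * (wRep 7 (derU3 1) z / 1451520)) z :=
  (((hasDerivAt_wRep_bSteps 0 0 bOne hz).sub
    (((hasDerivAt_wRep_bSteps 2 0 polU1 hz).div_const 12).const_mul e)).sub
    (((hasDerivAt_wRep_bSteps 4 0 polU2 hz).div_const 2880).const_mul (e ^ 2))).sub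
    (((hasDerivAt_wRep_bSteps 6 0 polU3 hz).div_const 1451520).const_mul (e ^ 3))

/-- `Υ₁'` and `Υ₃'` are negative and help; `Υ₂'` is positive but smaller than `w'`, which suffices
as `e² ≤ 1`. -/
lemma strictMonoOn_kFun {e : ℝ} (he : 0 < e) (he1 : e ≤ 1) :
    StrictMonoOn (kFun e) (Set.Ioi 1) := by
  refine strictMonoOn_of_deriv_pos (convex_Ioi 1)
    (fun z hz => (hasDerivAt_kFun e hz).continuousAt.continuousWithinAt) fun z hz => ?_
  rw [interior_Ioi] at hz
  have hz : 1 < z := hz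
  rw [(hasDerivAt_kFun e hz).deriv]
  have hz0 : 0 < z := by linarith
  have h1 := mul_neg_of_pos_of_neg he (wRep_neg 3 posCheck_neg_derU1_one hz)
  have h3 := mul_neg_of_pos_of_neg (pow_pos he 3) (wRep_neg 7 posCheck_neg_derU3_one hz)
  have h2 : wRep 5 (derU2 1) z / 2880 < wRep 1 (derW 1) z := by
    have h := mul_lt_mul_of_pos_left (derU2_le_derW hz) (div_pos (wFun_pos hz) hz0)
    unfold uvEval at h
    unfold wRep
    have e1 : wFun z * bEval (derU2 1) (uFun z) (vFun z) / z ^ 5 = wFun z / z *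
        (bEval (derU2 1) (uFun z) (vFun z) * (z ^ 2)⁻¹ ^ 2) := by
      field_simp
    rw [e1, pow_one]
    linear_combination h / 2880
  have h4 := mul_lt_of_le_one (pow_pos he 2) (pow_le_one₀ he.le he1)
    ((div_pos (wRep_pos 5 posCheck_derU2_one hz) (by norm_num)).trans h2) h2
  linarith

lemma strictMonoOn_wFun : StrictMonoOn wFun (Set.Ioi 1) := by
  refine strictMonoOn_of_deriv_pos (convex_Ioi 1)
    (fun z hz => (hasDerivAt_wFun hz).continuousAt.continuousWithinAt) fun z hz => ?_
  rw [interior_Ioi] at hz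
  have hz : 1 < z := hz
  rw [(hasDerivAt_wFun hz).deriv]
  have := wFun_pos hz
  have := vFun_pos hz
  have hz0 : 0 < z := by linarith
  positivity

lemma continuousOn_wFun : ContinuousOn wFun (Set.Ici 1) := by
  have hw : wFun = fun z => (3 / 2 * (secTan z - Real.arccos (1 / z))) ^ (2 / 3 : ℝ) := by
    funext z; simp [wFun, zeta, secTan]
  rw [hw]
  exact (continuousOn_const.mul (continuous_secTan.continuousOn.sub
    continuous_arcsec_on)).rpow_const fun _ _ => Or.inr (by norm_num)

lemma wFun_one : wFun 1 = 0 := by simp [wFun, zeta]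

lemma exists_wFun_eq {c : ℝ} (hc : 0 < c) : ∃ z, 1 < z ∧ wFun z = c := by
  obtain ⟨b, hb, hb1⟩ : ∃ b, 1 < b ∧ c ≤ wFun b := by
    have hr : 0 < c ^ (3 / 2 : ℝ) := by positivity
    set r := c ^ (3 / 2 : ℝ) with hrdef
    -- At `r + 5` the root is at least `r + 4` and `arcsec ≤ π ≤ 4`, so `√(z² - 1) - arcsec z ≥ r =
    -- c^(3/2)`.
    refine ⟨r + 5, by linarith, ?_⟩
    have hz : 1 < r + 5 := by linarith
    have hT : r + 4 ≤ secTan (r + 5) := Real.le_sqrt_of_sq_le (by nlinarith)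
    have ha := Real.arccos_le_pi (1 / (r + 5))
    have hpi := Real.pi_le_four
    have h : c ^ 3 ≤ wFun (r + 5) ^ 3 := by
      have h1 : c ^ 3 = r ^ 2 := by
        rw [hrdef, ← Real.rpow_natCast, ← Real.rpow_natCast, ← Real.rpow_mul hc.le]; norm_num
      have h2 := qFun_eq hz
      have h3 : secTan (r + 5) * qFun (r + 5) / 3 ≥ r := by linarith
      rw [h1, wFun_cube hz, ← secTan_sq hz]
      nlinarith
    exact le_of_pow_le_pow_left₀ (by norm_num) (wFun_pos hz).le h
  obtain ⟨z, hz, hzc⟩ := intermediate_value_Icc hb.le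
    (continuousOn_wFun.mono Set.Icc_subset_Ici_self) (show c ∈ Set.Icc (wFun 1) (wFun b) from
      ⟨by rw [wFun_one]; exact hc.le, hb1⟩)
  refine ⟨z, lt_of_le_of_ne hz.1 ?_, hzc⟩
  rintro rfl
  rw [wFun_one] at hzc
  exact hc.ne hzc

/-! ### The Airy function -/

/-- Termwise differentiation on the ball of radius `|x| + 1`, dominated by the values at that radius
because `c k ≥ 0`. -/
lemma hasDerivAt_tsum_mul_pow {c : ℕ → ℝ} {n : ℕ → ℕ}
    (h0 : ∀ R : ℝ, 0 < R → Summable fun k => c k * R ^ n k)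
    (h1 : ∀ R : ℝ, 0 < R → Summable fun k => c k * n k * R ^ (n k - 1)) (hc : ∀ k, 0 ≤ c k)
    (x : ℝ) :
    HasDerivAt (fun x => ∑' k, c k * x ^ n k) (∑' k, c k * n k * x ^ (n k - 1)) x := by
  have hR : (0 : ℝ) < |x| + 1 := by positivity
  refine hasDerivAt_tsum_of_isPreconnected (t := Metric.ball (0 : ℝ) (|x| + 1))
    (g := fun k y => c k * y ^ n k) (g' := fun k y => c k * n k * y ^ (n k - 1)) (y₀ := x)
    (h1 _ hR) Metric.isOpen_ball (convex_ball _ _).isPreconnected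
    (fun k y _ => ?_) (fun k y hy => ?_) (by simp) ?_ (by simp)
  · simpa only [mul_assoc] using (hasDerivAt_pow (n k) y).const_mul (c k)
  · have hy : |y| ≤ |x| + 1 := by simpa using (mem_ball_zero_iff.1 hy).le
    rw [Real.norm_eq_abs, abs_mul, abs_pow, abs_of_nonneg (mul_nonneg (hc k) (Nat.cast_nonneg _))]
    exact mul_le_mul_of_nonneg_left (pow_le_pow_left₀ (abs_nonneg _) hy _)
      (mul_nonneg (hc k) (Nat.cast_nonneg _))
  · refine Summable.of_norm_bounded (h0 _ hR) fun k => ?_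
    rw [Real.norm_eq_abs, abs_mul, abs_pow, abs_of_nonneg (hc k)]
    exact mul_le_mul_of_nonneg_left (pow_le_pow_left₀ (abs_nonneg _) (by linarith) _) (hc k)

/-- A power series `∑ cₖ x^(3k+r)` with the coefficient recurrence of `y'' = x y` solves it. -/
lemma airy_series_ode {c : ℕ → ℝ} {r : ℕ} (hr : r ≤ 1) (hc : ∀ k, 0 ≤ c k)
    (hrec : ∀ k, c (k + 1) * ((3 * k + r + 3 : ℝ) * (3 * k + r + 2)) = c k) :
    ∃ f' : ℝ → ℝ, ∀ x, HasDerivAt (fun x => ∑' k, c k * x ^ (3 * k + r)) (f' x) x ∧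
      HasDerivAt f' (x * ∑' k, c k * x ^ (3 * k + r)) x := by
  have hbound : ∀ k, c k ≤ c 0 / k.factorial := by
    intro k
    induction k with
    | zero => simp
    | succ k ih =>
      have hk : (0 : ℝ) < (k + 1 : ℝ) := by positivity
      have h2 : c (k + 1) * (k + 1) ≤ c k := by
        rw [← hrec k]
        refine mul_le_mul_of_nonneg_left ?_ (hc _)
        have : (0 : ℝ) ≤ k := by positivity
        have : (0 : ℝ) ≤ r := by positivity
        nlinarith
      rw [Nat.factorial_succ, Nat.cast_mul, Nat.cast_succ, mul_comm, ← div_div, le_div_iff₀ hk]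
      exact h2.trans ih
  have s0 : ∀ R : ℝ, 0 < R → Summable fun k => c k * R ^ (3 * k) := fun R hR => by
    refine Summable.of_nonneg_of_le (fun k => mul_nonneg (hc k) (by positivity)) (fun k => ?_)
      ((Real.summable_pow_div_factorial (R ^ 3)).mul_left (c 0))
    rw [← pow_mul, mul_div_assoc', mul_comm, mul_comm (c 0), mul_div_assoc]
    exact mul_le_mul_of_nonneg_left (hbound k) (by positivity)
  have s1 : ∀ R : ℝ, 0 < R → Summable fun k => c k * R ^ (3 * k + r) := fun R hR => by
    simpa only [pow_add, mul_assoc] using (s0 R hR).mul_right (R ^ r)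
  have s2 : ∀ R : ℝ, 0 < R →
      Summable fun k => c k * (3 * k + r : ℕ) * R ^ (3 * k + r - 1) := fun R hR => by
    rw [← summable_nat_add_iff 1]
    refine Summable.of_nonneg_of_le
      (fun k => mul_nonneg (mul_nonneg (hc _) (Nat.cast_nonneg _)) (by positivity)) (fun k => ?_)
      ((s1 R hR).mul_right (R ^ 2))
    rw [show 3 * (k + 1) + r - 1 = 3 * k + r + 2 by omega, pow_add, ← mul_assoc]
    refine mul_le_mul_of_nonneg_right (mul_le_mul_of_nonneg_right ?_ (by positivity))
      (by positivity)
    rw [← hrec k]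
    refine mul_le_mul_of_nonneg_left ?_ (hc _)
    push_cast
    have : (0 : ℝ) ≤ k := by positivity
    have : (0 : ℝ) ≤ r := by positivity
    nlinarith
  have hterm : ∀ (x : ℝ) (k : ℕ), c (k + 1) * (3 * (k + 1) + r : ℕ) * (3 * (k + 1) + r - 1 : ℕ) *
      x ^ (3 * (k + 1) + r - 1 - 1) = x * (c k * x ^ (3 * k + r)) := fun x k => by
    rw [show 3 * (k + 1) + r - 1 = 3 * k + r + 2 by omega,
      show 3 * k + r + 2 - 1 = 3 * k + r + 1 by omega, ← hrec k]
    push_cast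
    ring
  have s3 : ∀ R : ℝ, 0 < R → Summable fun k => c k * (3 * k + r : ℕ) * (3 * k + r - 1 : ℕ) *
      R ^ (3 * k + r - 1 - 1) := fun R hR => by
    rw [← summable_nat_add_iff 1]
    simp only [hterm]
    exact (s1 R hR).mul_left R
  refine ⟨fun x => ∑' k, c k * (3 * k + r : ℕ) * x ^ (3 * k + r - 1), fun x =>
    ⟨hasDerivAt_tsum_mul_pow s1 s2 hc x, ?_⟩⟩
  have h := hasDerivAt_tsum_mul_pow s2 s3 (fun k => mul_nonneg (hc k) (Nat.cast_nonneg _)) x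
  convert h using 1
  have hs : Summable fun k => c k * (3 * k + r : ℕ) * (3 * k + r - 1 : ℕ) *
      x ^ (3 * k + r - 1 - 1) := by
    rw [← summable_nat_add_iff 1]
    simp only [hterm]
    refine Summable.mul_left x (Summable.of_norm_bounded (s1 (|x| + 1) (by positivity))
      fun k => ?_)
    rw [Real.norm_eq_abs, abs_mul, abs_pow, abs_of_nonneg (hc k)]
    exact mul_le_mul_of_nonneg_left (pow_le_pow_left₀ (abs_nonneg _) (by linarith) _) (hc k)
  -- The term `k = 0` of the second derivative carries `r (r - 1)`, which vanishes as `r ≤ 1`; the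
  -- remaining terms shift to `x` times the series.
  rw [hs.tsum_eq_zero_add]
  simp only [hterm]
  rw [tsum_mul_left]
  interval_cases r <;> simp

lemma airyAi_ode : ∃ f' : ℝ → ℝ, ∀ x, HasDerivAt airyAi (f' x) x ∧
    HasDerivAt f' (x * airyAi x) x := by
  obtain ⟨f', hf⟩ := airy_series_ode (r := 0)
    (c := fun k => (∏ i ∈ Finset.range k, (3 * (i : ℝ) + 1)) / ((3 * k).factorial : ℝ))
    (by norm_num) (fun k => by positivity) (fun k => by
      rw [Finset.prod_range_succ, show 3 * (k + 1) = 3 * k + 1 + 1 + 1 by ring,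
        Nat.factorial_succ, Nat.factorial_succ, Nat.factorial_succ]
      push_cast
      field_simp
      ring)
  obtain ⟨g', hg⟩ := airy_series_ode (r := 1)
    (c := fun k => (∏ i ∈ Finset.range k, (3 * (i : ℝ) + 2)) / ((3 * k + 1).factorial : ℝ))
    (by norm_num) (fun k => by positivity) (fun k => by
      rw [Finset.prod_range_succ, show 3 * (k + 1) + 1 = 3 * k + 1 + 1 + 1 + 1 by ring,
        Nat.factorial_succ (3 * k + 1 + 1 + 1), Nat.factorial_succ (3 * k + 1 + 1),
        Nat.factorial_succ (3 * k + 1)]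
      push_cast
      field_simp
      ring)
  refine ⟨fun x => 1 / ((3 : ℝ) ^ (2 / 3 : ℝ) * Real.Gamma (2 / 3)) * f' x -
    1 / ((3 : ℝ) ^ (1 / 3 : ℝ) * Real.Gamma (1 / 3)) * g' x, fun x => ⟨?_, ?_⟩⟩
  · exact ((hf x).1.const_mul _).sub ((hg x).1.const_mul _)
  · refine (((hf x).2.const_mul _).sub ((hg x).2.const_mul _)).congr_deriv ?_
    simp only [airyAi, add_zero]
    ring

lemma airyAi_zero_ne_zero : airyAi 0 ≠ 0 := by
  have h1 : ∑' k : ℕ, (∏ i ∈ Finset.range k, (3 * (i : ℝ) + 1)) / ((3 * k).factorial : ℝ) *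
      (0 : ℝ) ^ (3 * k) = 1 := by
    rw [tsum_eq_single 0 fun k hk => by simp [hk]]
    simp
  have hG : 0 < Real.Gamma (2 / 3) := Real.Gamma_pos_of_pos (by norm_num)
  have : airyAi 0 = 1 / ((3 : ℝ) ^ (2 / 3 : ℝ) * Real.Gamma (2 / 3)) := by
    simp [airyAi, h1]
  rw [this]
  positivity

lemma exists_sub_eq_mul {f f' : ℝ → ℝ} (hf : ∀ x, HasDerivAt f (f' x) x) {x y : ℝ} (h : x < y) :
    ∃ t, x < t ∧ t < y ∧ f y - f x = f' t * (y - x) := by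
  obtain ⟨t, ht, h2⟩ := exists_hasDerivAt_eq_slope f f' h
    (fun t _ => (hf t).continuousAt.continuousWithinAt) fun t _ => hf t
  have : y - x ≠ 0 := (sub_pos.2 h).ne'
  exact ⟨t, ht.1, ht.2, by rw [h2]; field_simp⟩

/-- No solution of `y'' = x y` stays positive towards `-∞`. -/
lemma exists_nonpos_of_airy_ode {f f' : ℝ → ℝ} (hf : ∀ x, HasDerivAt f (f' x) x)
    (hf' : ∀ x, HasDerivAt f' (x * f x) x) (A : ℝ) : ∃ x < A, f x ≤ 0 := by
  by_contra! hpos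
  -- A solution positive on `(-∞, A)` is concave for negative arguments.
  have hanti : ∀ {x y}, x < y → y < A → y < 0 → f' y < f' x := fun {x y} hxy hyA hy => by
    obtain ⟨t, h1, h2, h3⟩ := exists_sub_eq_mul hf' hxy
    have := mul_neg_of_neg_of_pos
      (mul_neg_of_neg_of_pos (h2.trans hy) (hpos t (h2.trans hyA))) (sub_pos.2 hxy)
    linarith
  have hnonpos : ∀ y, y < A → y < 0 → f' y ≤ 0 := fun y hyA hy => by
    by_contra! hs
    have hfy := hpos y hyA
    -- If the slope at `y` were positive, the tangent there would vanish at this point, and the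
    -- concave graph lies below it.
    have hxy : y - f y / f' y < y := by
      have := div_pos hfy hs
      linarith
    obtain ⟨t, h1, h2, h3⟩ := exists_sub_eq_mul hf hxy
    have h4 := mul_lt_mul_of_pos_right (hanti h2 hyA hy) (sub_pos.2 hxy)
    have h5 : f' y * (y - (y - f y / f' y)) = f y := by field_simp; ring
    have := hpos _ (hxy.trans hyA)
    linarith
  obtain ⟨b, hbA, hb1⟩ : ∃ b < A, b < -1 := ⟨min A (-1) - 1, by
    have := min_le_left A (-1); linarith, by have := min_le_right A (-1); linarith⟩
  have hfb := hpos b hbA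
  have hge : ∀ x < b, f b ≤ f x := fun x hx => by
    obtain ⟨t, h1, h2, h3⟩ := exists_sub_eq_mul hf hx
    have := mul_nonpos_of_nonpos_of_nonneg (hnonpos t (h2.trans hbA) (by linarith))
      (sub_pos.2 hx).le
    linarith
  have hr : 0 ≤ -f' b / f b := div_nonneg (by linarith [hnonpos b hbA (by linarith)]) hfb.le
  -- To the left of `b < -1` one has `f'' ≤ -f b`. Over this length `f'` rises leftwards from `f' b`
  -- to at least `f b > 0`, contradicting `hnonpos`.
  have hxb : b - (-f' b / f b + 1) < b := by linarith
  obtain ⟨t, h1, h2, h3⟩ := exists_sub_eq_mul hf' hxb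
  have h4 : t * f t ≤ -f b := by
    nlinarith [hge t h2]
  have h5 := mul_le_mul_of_nonneg_right h4 (sub_pos.2 hxb).le
  have h6 : -f b * (b - (b - (-f' b / f b + 1))) = f' b - f b := by field_simp; ring
  have := hnonpos _ (hxb.trans hbA) (by linarith)
  linarith

/-- Neither `Ai` nor `-Ai` stays positive below `A`, so `Ai` changes sign or vanishes there. This
makes every set in `airyZero` nonempty, so that its `sSup` is not the default value. -/
lemma exists_airyAi_eq_zero (A : ℝ) : ∃ x < A, airyAi x = 0 := by
  obtain ⟨f', hf⟩ := airyAi_ode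
  obtain ⟨x, hx, h1⟩ := exists_nonpos_of_airy_ode (fun x => (hf x).1) (fun x => (hf x).2) A
  obtain ⟨y, hy, h2⟩ := exists_nonpos_of_airy_ode (f := fun x => -airyAi x) (f' := fun x => -f' x)
    (fun x => (hf x).1.neg) (fun x => by exact (hf x).2.neg.congr_deriv (by ring)) A
  have hcont : Continuous airyAi :=
    continuous_iff_continuousAt.2 fun x => (hf x).1.continuousAt
  obtain ⟨t, ht, h3⟩ := isPreconnected_Iio.intermediate_value (Set.mem_Iio.2 hx)
    (Set.mem_Iio.2 hy) hcont.continuousOn ⟨h1, by linarith⟩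
  exact ⟨t, ht, h3⟩

lemma airyZero_succ_le (m : ℕ) : airyZero (m + 1) ≤ airyZero m :=
  csSup_le (exists_airyAi_eq_zero _) fun _ hx => hx.1.le

/-- A supremum of negative numbers could still be 0; `Ai 0 ≠ 0` and continuity keep the zeros away
from 0. -/
lemma airyZero_one_neg : airyZero 1 < 0 := by
  obtain ⟨f', hf⟩ := airyAi_ode
  obtain ⟨δ, hδ, h⟩ := Metric.eventually_nhds_iff.1
    ((hf 0).1.continuousAt.eventually_ne airyAi_zero_ne_zero)
  refine lt_of_le_of_lt (csSup_le (exists_airyAi_eq_zero _) fun x hx => ?_) (neg_lt_zero.2 hδ)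
  by_contra! hlt
  have hx0 : x < 0 := hx.1
  exact h (by rw [Real.dist_eq, sub_zero, abs_of_neg hx0]; linarith) hx.2

theorem airyZero_neg {m : ℕ} (hm : 1 ≤ m) : airyZero m < 0 := by
  induction m, hm using Nat.le_induction with
  | base => exact airyZero_one_neg
  | succ m _ ih => exact (airyZero_succ_le m).trans_lt ih

/-! ### The two zeros -/

theorem exists_kFun_eq {e z : ℝ} (he : 0 < e) (he1 : e ≤ 1) (hz : 1 < z) :
    ∃ x, 1 < x ∧ kFun e x = wFun z ∧ z * (1 + relShift e 0.969746 z) < x ∧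
      x < z * (1 + relShift e 1.013023 z) := by
  obtain ⟨ha, hb, hc, hba, hcb⟩ := shift_coefficients hz
  have hlow := kFun_lower_lt he he1 hz
  have hupp := lt_kFun_upper he he1 hz
  have h0 : 0 < relShift e 0.969746 z :=
    (reversion_bounds he he1 ha hb hc (by norm_num) hba (hcb _ (by norm_num)) rfl).1
  have h1 : 0 < relShift e 1.013023 z :=
    (reversion_bounds he he1 ha hb hc (by norm_num) hba (hcb _ (by norm_num)) rfl).1
  have hx : 1 < z * (1 + relShift e 0.969746 z) := by nlinarith
  have hy : 1 < z * (1 + relShift e 1.013023 z) := by nlinarith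
  have hmono := strictMonoOn_kFun he he1
  obtain ⟨x, hx1, hxe⟩ := (isPreconnected_Ioi (a := (1 : ℝ))).intermediate_value
    (Set.mem_Ioi.2 hx) (Set.mem_Ioi.2 hy)
    (fun z hz => (hasDerivAt_kFun e hz).continuousAt.continuousWithinAt)
    (show wFun z ∈ Set.Icc _ _ from ⟨hlow.le, hupp.le⟩)
  -- Strict monotonicity of `K` turns the strict inequalities between values into strict bounds on
  -- `x`.
  exact ⟨x, hx1, hxe, (hmono.lt_iff_lt hx hx1).1 (by rwa [hxe]),
    (hmono.lt_iff_lt hx1 hy).1 (by rwa [hxe])⟩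

lemma mem_zLeadSet {ν z : ℝ} {m : ℕ} : z ∈ zLeadSet ν m ↔
    1 < z ∧ wFun z = -(ν ^ (-(2 / 3) : ℝ) * airyZero m) := by
  rw [zLeadSet, Set.mem_ofPred_eq, wFun, neg_inj]

lemma mem_zImplicitSet {ν z : ℝ} {m : ℕ} : z ∈ zImplicitSet ν m ↔
    1 < z ∧ kFun (1 / ν ^ 2) z = -(ν ^ (-(2 / 3) : ℝ) * airyZero m) := by
  refine and_congr_right fun hz => ?_
  rw [scriptZ3_eq ν hz]
  constructor <;> intro h <;> linear_combination -h

end BesselZeros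

theorem theorem1p3 (m : ℕ) (hm : 1 ≤ m) (ν : ℝ) (hν : 1 ≤ ν) :
    (∃! z, z ∈ BesselZeros.zLeadSet ν m) ∧
    (∃! z, z ∈ BesselZeros.zImplicitSet ν m) ∧
    ∃ e : ℝ,
      BesselZeros.zImplicit ν m = BesselZeros.zBold ν m + e ∧
      0.969746 * BesselZeros.zHat3 (BesselZeros.zLead ν m) / ν ^ 6 < e ∧
      e < 1.013023 * BesselZeros.zHat3 (BesselZeros.zLead ν m) / ν ^ 6 := by
  open BesselZeros in
  have hν0 : 0 < ν := by linarith
  have he : 0 < 1 / ν ^ 2 := by positivity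
  have he1 : 1 / ν ^ 2 ≤ 1 := by
    rw [div_le_one (by positivity)]
    exact one_le_pow₀ hν
  have hc : 0 < -(ν ^ (-(2 / 3) : ℝ) * airyZero m) :=
    neg_pos.2 (mul_neg_of_pos_of_neg (by positivity) (airyZero_neg hm))
  obtain ⟨z, hz, hzc⟩ := exists_wFun_eq hc
  obtain ⟨x, hx, hxc, hlow, hupp⟩ := exists_kFun_eq he he1 hz
  rw [hzc] at hxc
  -- As singletons, the two solution sets have as `sInf` their unique element, not a default value.
  have hlead : zLeadSet ν m = {z} := Set.eq_singleton_iff_unique_mem.2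
    ⟨mem_zLeadSet.2 ⟨hz, hzc⟩, fun y hy => strictMonoOn_wFun.injOn (mem_zLeadSet.1 hy).1 hz
      ((mem_zLeadSet.1 hy).2.trans hzc.symm)⟩
  have himpl : zImplicitSet ν m = {x} := Set.eq_singleton_iff_unique_mem.2
    ⟨mem_zImplicitSet.2 ⟨hx, hxc⟩, fun y hy =>
      (strictMonoOn_kFun he he1).injOn (mem_zImplicitSet.1 hy).1 hx
        ((mem_zImplicitSet.1 hy).2.trans hxc.symm)⟩
  have hzLead : zLead ν m = z := by rw [zLead, hlead, csInf_singleton]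
  have hzImpl : zImplicit ν m = x := by rw [zImplicit, himpl, csInf_singleton]
  refine ⟨by simp [hlead], by simp [himpl], x - zBold ν m, by rw [hzImpl]; ring, ?_, ?_⟩
  · rw [mul_one_add_relShift _ _ hz] at hlow
    rw [zBold, hzLead]
    linear_combination hlow
  · rw [mul_one_add_relShift _ _ hz] at hupp
    rw [zBold, hzLead]
    linear_combination hupp
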